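/- Let $T$ be a compact metric space, let $\mathbb C^+$ be the set of non-negative continuous functions on $T$ with the uniform norm $\|x\|=\sup_{t\in T}x(t)$, and let $\mathbb C_0^+=\mathbb C^+\setminus\{0\}$. Let $\overline{\mathbb C}_0^+=(0,+\infty]\times\{s\in\mathbb C^+:\|s\|=1\}$, with the metric $d((r_1,s_1),(r_2,s_2))=|1/r_1-1/r_2|+\|s_1-s_2\|$ (where $1/\infty=0$); identify $\mathbb C_0^+$ with the points of finite radius $r<\infty$ of $\overline{\mathbb C}_0^+$ through $x\mapsto(\|x\|,x/\|x\|)$. A Borel measure on a metric space is boundedly finite if it is finite on bounded Borel sets; boundedly finite measures $\mu_n$ converge $\sharp$-weakly to a boundedly finite measure $\nu$ if $\int f\,d\mu_n\to\int f\,d\nu$ for every bounded continuous function $f$ with bounded support. For each $n\ge 1$ let $X_n$ be a random element of $\mathbb C^+$ and let $(X_{in})_{i\ge1}$ be independent copies of $X_n$. Assume that the measures $n\,\mathbb P[X_n\in\cdot\,]$, restricted to $\mathbb C_0^+$ and regarded as measures on $\overline{\mathbb C}_0^+$, converge $\sharp$-weakly to a boundedly finite measure $\nu$ on $\overline{\mathbb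 C}_0^+$, and that $\nu(\overline{\mathbb C}_0^+\setminus\mathbb C_0^+)=0$. Let $\sum_i\delta_{(Y_i,U_i)}$ (a finite or countable sum) be a Poisson point process on $\mathbb C_0^+\times[0,\infty)$ with intensity $\nu\otimes\ell$, where $\ell$ is the Lebesgue measure on $[0,\infty)$; here boundedness in $\mathbb C_0^+$ is understood for $d$, so that only finitely many points satisfy $\|Y_i\|\ge\varepsilon$ and $U_i\le K$, for all $\varepsilon,K>0$. Then the formulas $$\tilde M_n(u,t)=\max_{1\le i\le[nu]}X_{in}(t),\qquad \tilde M(u,t)=\sup_i\,Y_i(t)\,\mathbf 1_{[U_i,\infty)}(u),\qquad u\ge0,\ t\in T$$ (a maximum or supremum over the empty set being $0$) define random elements $\tilde M_n$, $\tilde M$ of the Skorokhod space $\mathbb D([0,\infty),\mathbb C^+)$ of càdlàg functions with the $J_1$ topology, and $\tilde M_n$ converges weakly to $\tilde M$ in $\mathbb D([0,\infty),\mathbb C^+)$ as $n\to\infty$. -/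

import Mathlib

open MeasureTheory ProbabilityTheory Filter Topology Set
open scoped NNReal ENNReal BoundedContinuousFunction

noncomputable section

/-! ### Boundedly finite measures and point processes on a metric space -/

section PointProcesses

variable {E : Type*} [PseudoMetricSpace E] [MeasurableSpace E]

/-- A measure is boundedly finite if every bounded Borel set has finite measure. -/
def BoundedlyFinite (μ : Measure E) : Prop :=
  ∀ B : Set E, MeasurableSet B → Bornology.IsBounded B → μ B < ∞

/-- `♯`-weak convergence of a sequence of boundedly finite measures to a boundedly finite measure:
convergence of the integrals of bounded continuous functions with bounded support. -/
structure SharpWeakTendsto (μ : ℕ → Measure E) (ν : Measure E) : Prop where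
  boundedlyFinite : ∀ n, BoundedlyFinite (μ n)
  boundedlyFinite_limit : BoundedlyFinite ν
  tendsto : ∀ f : E →ᵇ ℝ, Bornology.IsBounded (Function.support f) →
    Tendsto (fun n => ∫ x, f x ∂(μ n)) atTop (𝓝 (∫ x, f x ∂ν))

/-- A boundedly finite point measure: the sum of the Dirac masses at a finite or countable family
of points, only finitely many of which lie in any given bounded set. -/
def IsPointMeasure (μ : Measure E) : Prop :=
  ∃ (I : Set ℕ) (x : I → E), μ = Measure.sum (fun i => Measure.dirac (x i)) ∧
    ∀ B : Set E, Bornology.IsBounded B → {i | x i ∈ B}.Finite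

/-- `N` is a Poisson point process with intensity `μ` on the probability space `(Ω, P)`: a random
boundedly finite point measure such that the number of points in a bounded Borel set `B` is
Poisson distributed with mean `μ B`, and such that the numbers of points in finitely many pairwise
disjoint bounded Borel sets are independent. -/
structure IsPoissonPointProcess {Ω : Type*} [MeasurableSpace Ω] (N : Ω → Measure E)
    (μ : Measure E) (P : Measure Ω) : Prop where
  measurable : Measurable N
  isPointMeasure : ∀ ω, IsPointMeasure (N ω)
  map_apply : ∀ B : Set E, MeasurableSet B → Bornology.IsBounded B →
    P.map (fun ω => N ω B) =
      (poissonMeasure (μ B).toNNReal).map (fun k : ℕ => (k : ℝ≥0∞))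
  iIndepFun : ∀ (k : ℕ) (B : Fin k → Set E),
    (∀ i, MeasurableSet (B i)) → (∀ i, Bornology.IsBounded (B i)) →
    Pairwise (fun i j => Disjoint (B i) (B j)) →
    ProbabilityTheory.iIndepFun (fun i ω => N ω (B i)) P

end PointProcesses

/-- Lebesgue measure on `[0,∞)`. -/
def lebesgueHalfLine : Measure ℝ≥0 := (volume : Measure ℝ).comap (fun u : ℝ≥0 => (u : ℝ))

/-! ### The Skorokhod space with the `J₁` topology -/

/-- The Skorokhod space `D([0,∞), E)` of right-continuous functions with left limits. -/
structure SkorokhodSpace (E : Type*) [TopologicalSpace E] where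
  toFun : ℝ≥0 → E
  rightContinuous : ∀ u, ContinuousWithinAt toFun (Ici u) u
  leftLimit : ∀ u, ∃ l, Tendsto toFun (𝓝[<] u) (𝓝 l)

instance {E : Type*} [TopologicalSpace E] : CoeFun (SkorokhodSpace E) (fun _ => ℝ≥0 → E) :=
  ⟨SkorokhodSpace.toFun⟩

namespace SkorokhodSpace

variable {E : Type*} [PseudoMetricSpace E]

/-- Basic `J₁`-neighbourhood of `x`: the `y` that are `ε`-close to `x` on the time interval `[0, K]`
after a change of time `Λ` (an increasing bijection of `[0,∞)`) which is itself `ε`-close to the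
identity on `[0, K]`. -/
def basicNhd (x : SkorokhodSpace E) (K : ℝ≥0) (ε : ℝ) : Set (SkorokhodSpace E) :=
  {y | ∃ Λ : ℝ≥0 ≃o ℝ≥0, ∀ u ≤ K, dist (Λ u) u ≤ ε ∧ dist (y u) (x (Λ u)) ≤ ε}

theorem basicNhd_anti (x : SkorokhodSpace E) {K K' : ℝ≥0} {ε ε' : ℝ} (hK : K ≤ K') (hε : ε' ≤ ε) :
    x.basicNhd K' ε' ⊆ x.basicNhd K ε := by
  rintro y ⟨Λ, hΛ⟩
  exact ⟨Λ, fun u hu => ⟨(hΛ u (hu.trans hK)).1.trans hε, (hΛ u (hu.trans hK)).2.trans hε⟩⟩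

/-- The `J₁` topology. A sequence `xₙ` converges to `x` if and only if for all `K` there are
changes of time `Λₙ` such that `Λₙ u - u` and `dist (xₙ u) (x (Λₙ u))` tend to `0` uniformly
for `u ≤ K`. -/
instance : TopologicalSpace (SkorokhodSpace E) where
  IsOpen s := ∀ x ∈ s, ∃ K : ℝ≥0, ∃ ε > 0, x.basicNhd K ε ⊆ s
  isOpen_univ := fun _ _ => ⟨0, 1, one_pos, subset_univ _⟩
  isOpen_inter := by
    rintro s t hs ht x ⟨hxs, hxt⟩
    obtain ⟨K, ε, hε, h⟩ := hs x hxs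
    obtain ⟨K', ε', hε', h'⟩ := ht x hxt
    exact ⟨max K K', min ε ε', lt_min hε hε', subset_inter
      ((x.basicNhd_anti (le_max_left _ _) (min_le_left _ _)).trans h)
      ((x.basicNhd_anti (le_max_right _ _) (min_le_right _ _)).trans h')⟩
  isOpen_sUnion := by
    rintro S hS x ⟨s, hs, hxs⟩
    obtain ⟨K, ε, hε, h⟩ := hS s hs x hxs
    exact ⟨K, ε, hε, h.trans (subset_sUnion_of_mem hs)⟩

instance : MeasurableSpace (SkorokhodSpace E) := borel _

instance : BorelSpace (SkorokhodSpace E) := ⟨rfl⟩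

end SkorokhodSpace

/-! ### Non-negative continuous functions and polar coordinates -/

section Cone

/-- The space `C⁺(T)` of non-negative continuous functions, with the uniform distance. -/
abbrev CPlus (T : Type*) [TopologicalSpace T] := C(T, ℝ≥0)

instance {T : Type*} [TopologicalSpace T] : MeasurableSpace (CPlus T) := borel _

instance {T : Type*} [TopologicalSpace T] : BorelSpace (CPlus T) := ⟨rfl⟩

/-- `C₀⁺(T) = C⁺(T) \ {0}`. -/
abbrev CPlusZero (T : Type*) [TopologicalSpace T] := {x : CPlus T // x ≠ 0}

variable {T : Type*} [MetricSpace T] [CompactSpace T]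

/-- The uniform norm `‖x‖ = sup_t x(t)` on `C⁺(T)`. -/
def supNorm (x : CPlus T) : ℝ≥0 := nndist x 0

theorem supNorm_smul (c : ℝ≥0) (x : CPlus T) : supNorm (c • x) = c * supNorm x := by
  have key : ∀ y : CPlus T, ∀ b : ℝ≥0, supNorm y ≤ b ↔ ∀ t, y t ≤ b := by
    intro y b
    have h : dist y 0 ≤ b ↔ ∀ t, dist (y t) ((0 : C(T, ℝ≥0)) t) ≤ b := ContinuousMap.dist_le b.2
    rw [supNorm, ← NNReal.coe_le_coe, coe_nndist, h]
    simp [NNReal.dist_eq]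
  apply le_antisymm
  · rw [key]
    intro t
    rw [ContinuousMap.smul_apply, smul_eq_mul]
    gcongr
    exact (key x _).1 le_rfl t
  · rcases eq_or_ne c 0 with rfl | hc
    · simp
    · have hc' : 0 < c := pos_iff_ne_zero.2 hc
      rw [← le_div_iff₀' hc', key]
      intro t
      rw [le_div_iff₀' hc']
      exact (key (c • x) _).1 le_rfl t

theorem supNorm_ne_zero {x : CPlus T} (hx : x ≠ 0) : supNorm x ≠ 0 := by
  simpa [supNorm] using hx

variable (T) in
/-- The extended cone `(0,∞] × S` where `S` is the unit sphere of `C⁺(T)`. -/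
@[ext] structure ExtCone where
  radius : ℝ≥0∞
  shape : CPlus T
  radius_ne_zero : radius ≠ 0
  supNorm_shape : supNorm shape = 1

namespace ExtCone

/-- The distance `d((r₁,s₁),(r₂,s₂)) = |1/r₁ - 1/r₂| + ‖s₁ - s₂‖`, with `1/∞ = 0`. -/
instance : MetricSpace (ExtCone T) where
  dist p q := |(p.radius⁻¹).toReal - (q.radius⁻¹).toReal| + dist p.shape q.shape
  dist_self p := by simp
  dist_comm p q := by rw [abs_sub_comm, dist_comm p.shape]
  dist_triangle p q r := by
    have h1 := abs_sub_le (p.radius⁻¹).toReal (q.radius⁻¹).toReal (r.radius⁻¹).toReal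
    have h2 := dist_triangle p.shape q.shape r.shape
    linarith
  eq_of_dist_eq_zero {p q} h := by
    have h1 := abs_nonneg ((p.radius⁻¹).toReal - (q.radius⁻¹).toReal)
    have h2 : 0 ≤ dist p.shape q.shape := dist_nonneg
    have h3 : |(p.radius⁻¹).toReal - (q.radius⁻¹).toReal| = 0 := by linarith
    have h4 : dist p.shape q.shape = 0 := by linarith
    refine ExtCone.ext ?_ (dist_eq_zero.1 h4)
    rw [abs_eq_zero, sub_eq_zero, ENNReal.toReal_eq_toReal_iff'
      (ENNReal.inv_ne_top.2 p.radius_ne_zero) (ENNReal.inv_ne_top.2 q.radius_ne_zero)] at h3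
    exact inv_injective h3

instance : MeasurableSpace (ExtCone T) := borel _

instance : BorelSpace (ExtCone T) := ⟨rfl⟩

/-- The polar decomposition `x ↦ (‖x‖, x / ‖x‖)`, which identifies `C₀⁺(T)` with the set of points
of finite radius. -/
def polar (x : CPlusZero T) : ExtCone T where
  radius := supNorm x.1
  shape := (supNorm x.1)⁻¹ • x.1
  radius_ne_zero := by simpa using supNorm_ne_zero x.2
  supNorm_shape := by rw [supNorm_smul, inv_mul_cancel₀ (supNorm_ne_zero x.2)]

/-- The measure on the extended cone induced by a measure `μ` on `C⁺(T)`: restrict `μ` to `C₀⁺(T)`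
and transport it by the polar decomposition. -/
def inducedMeasure (μ : Measure (CPlus T)) : Measure (ExtCone T) :=
  (μ.comap (Subtype.val : CPlusZero T → CPlus T)).map polar

end ExtCone

end Cone

end

/-! The proof discretizes space and time and needs no tightness argument. Fix `δ`. Above a low level
`ε` the limit measure has finite mass, so `exists_partition` cuts the functions of norm at least `ε`
into finitely many small cells with null frontiers and a remainder of small mass. A time interval
`[0, K]` is cut into slabs of length `h`. Let `ξ` be the random set of products (cell × slab) that
contain a point, the `n`-th sample being read as the points `(X i, (i + 1) / n)` with `i` counted
from `0`.

Two facts carry the argument. The deterministic one is `IsSupPath.mem_basicNhd`: if the remainder is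
unoccupied and each slab has at most one occupied cell, the running supremum is `J₁`-close to a path
`z ξ` depending on `ξ` alone. The time change sends the first exceedance of `ε` in a slab to the end
of that slab, and smaller points matter by at most `ε`. The probabilistic one is that the law of `ξ`
is determined by the numbers `P (ξ ⊆ S)`, which are void probabilities. For the samples,
independence turns them into products of powers `(1 - p) ^ m` with `n p → ν B` and `m / n → h`
(`tendsto_occupiedCells_maxima_subset`); for the Poisson process they equal the limiting
exponentials (`measureReal_occupiedCells_subset`). So the laws of `ξ` converge.

Bad configurations have small probability for the Poisson process: at most `K` times the mass of the
remainder, plus `O(h²)` for each of the `K / h` slabs. Convergence of the laws of `ξ` transfers this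
bound to the samples. Comparing both paths with `z ξ` under bounded Lipschitz test functions gives
weak convergence (`FinitelyApproximable.tendstoInDistribution`). A metric for `J₁` comes from a
countable basis of entourages, and measurability of the limit path from the same approximations by
Borel–Cantelli. -/

namespace SkorokhodSpace

/-! ### The uniform structure behind the `J₁` topology -/

variable {E : Type*} [PseudoMetricSpace E]

theorem self_mem_basicNhd (x : SkorokhodSpace E) (K : ℝ≥0) {ε : ℝ} (hε : 0 ≤ ε) :
    x ∈ x.basicNhd K ε :=
  ⟨OrderIso.refl _, fun u _ => by simp [hε]⟩

/-- Since `Λ` moves `K + 1` by at most `1`, it sends it to at least `K`. Inverse time changes on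
`[0, K]` thus stay where `Λ` is controlled, which is why symmetry costs one unit of horizon. -/
theorem le_apply_of_dist_le {Λ : ℝ≥0 ≃o ℝ≥0} {K : ℝ≥0}
    (hΛ : ∀ u ≤ K + 1, dist (Λ u) u ≤ 1) {v : ℝ≥0} (hv : v ≤ K) : Λ.symm v ≤ K + 1 := by
  by_contra! h
  have h1 : Λ (K + 1) < v := by rwa [← Λ.lt_symm_apply]
  have h2 := hΛ (K + 1) le_rfl
  rw [NNReal.dist_eq, abs_le] at h2
  have h3 : (Λ (K + 1) : ℝ) < v := h1
  have h4 : (v : ℝ) ≤ K := hv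
  push_cast at h2
  linarith

theorem basicNhd_symm {x y : SkorokhodSpace E} {K : ℝ≥0} {ε : ℝ} (hε : ε ≤ 1)
    (h : y ∈ x.basicNhd (K + 1) ε) : x ∈ y.basicNhd K ε := by
  obtain ⟨Λ, hΛ⟩ := h
  refine ⟨Λ.symm, fun v hv => ?_⟩
  have := hΛ (Λ.symm v) (le_apply_of_dist_le (fun u hu => (hΛ u hu).1.trans hε) hv)
  rw [Λ.apply_symm_apply] at this
  exact ⟨by rw [dist_comm]; exact this.1, by rw [dist_comm]; exact this.2⟩

theorem basicNhd_comp {x y z : SkorokhodSpace E} {K : ℝ≥0} {ε : ℝ} (hε : ε ≤ 1)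
    (hxy : y ∈ x.basicNhd (K + 1) ε) (hyz : z ∈ y.basicNhd K ε) : z ∈ x.basicNhd K (2 * ε) := by
  obtain ⟨Λ, hΛ⟩ := hxy
  obtain ⟨Λ', hΛ'⟩ := hyz
  refine ⟨Λ'.trans Λ, fun u hu => ?_⟩
  have h' := hΛ' u hu
  have hle : Λ' u ≤ K + 1 := by
    have h1 := h'.1
    rw [NNReal.dist_eq, abs_le] at h1
    have h4 : (u : ℝ) ≤ K := hu
    rw [← NNReal.coe_le_coe]
    push_cast
    linarith
  have h := hΛ _ hle
  simp only [OrderIso.trans_apply]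
  constructor
  · linarith [dist_triangle (Λ (Λ' u)) (Λ' u) u]
  · linarith [dist_triangle (z u) (y (Λ' u)) (x (Λ (Λ' u)))]

/-- Entourages of the `J₁` uniform structure. -/
def entourage (n : ℕ) : Set (SkorokhodSpace E × SkorokhodSpace E) :=
  {p | p.2 ∈ p.1.basicNhd n (1 / (n + 1))}

theorem entourage_anti : Antitone (entourage : ℕ → Set (SkorokhodSpace E × SkorokhodSpace E)) := by
  intro m n hmn p hp
  refine p.1.basicNhd_anti (by exact_mod_cast hmn) ?_ hp
  exact Nat.one_div_le_one_div hmn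

theorem exists_entourage_subset (K : ℝ≥0) {ε : ℝ} (hε : 0 < ε) :
    ∃ n, ∀ x y : SkorokhodSpace E, (x, y) ∈ entourage n → y ∈ x.basicNhd K ε := by
  obtain ⟨n, hn⟩ := exists_nat_one_div_lt hε
  obtain ⟨m, hm⟩ := exists_nat_ge K
  refine ⟨max n m, fun x y h => x.basicNhd_anti ?_ ?_ h⟩
  · exact hm.trans (by exact_mod_cast le_max_right n m)
  · exact (Nat.one_div_le_one_div (le_max_left n m)).trans hn.le

/-- The entourages form a filter basis. -/
def entourageBasis : FilterBasis (SkorokhodSpace E × SkorokhodSpace E) where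
  sets := range entourage
  nonempty := range_nonempty _
  inter_sets := by
    rintro _ _ ⟨m, rfl⟩ ⟨n, rfl⟩
    exact ⟨_, ⟨max m n, rfl⟩, subset_inter (entourage_anti (le_max_left _ _))
      (entourage_anti (le_max_right _ _))⟩

/-- The core of the `J₁` uniform structure. -/
def uniformCore : UniformSpace.Core (SkorokhodSpace E) :=
  UniformSpace.Core.mkOfBasis entourageBasis
    (by
      rintro _ ⟨n, rfl⟩ x
      exact x.self_mem_basicNhd _ (by positivity))
    (by
      rintro _ ⟨n, rfl⟩
      refine ⟨_, ⟨n + 1, rfl⟩, fun p hp => ?_⟩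
      have hp' : p.2 ∈ p.1.basicNhd (n + 1) (1 / (n + 1)) :=
        p.1.basicNhd_anti (by push_cast; exact le_rfl)
          (Nat.one_div_le_one_div (Nat.le_succ n)) hp
      refine basicNhd_symm ((div_le_one (by positivity)).2 ?_) hp'
      linarith [n.cast_nonneg (α := ℝ)])
    (by
      rintro _ ⟨n, rfl⟩
      refine ⟨_, ⟨2 * n + 1, rfl⟩, ?_⟩
      rintro ⟨x, z⟩ ⟨y, hxy, hyz⟩
      have hn : (0 : ℝ) ≤ n := n.cast_nonneg
      have e : (1 : ℝ) / ((2 * n + 1 : ℕ) + 1) = (1 / (n + 1)) / 2 := by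
        push_cast; field_simp; ring
      have hxy' : y ∈ x.basicNhd (n + 1) ((1 / (n + 1)) / 2) :=
        x.basicNhd_anti (by push_cast; gcongr; exact le_mul_of_one_le_left' one_le_two) e.le hxy
      have hyz' : z ∈ y.basicNhd n ((1 / (n + 1)) / 2) :=
        y.basicNhd_anti (by exact_mod_cast (by omega : n ≤ 2 * n + 1)) e.le hyz
      have h1 : (1 : ℝ) / (n + 1) ≤ 1 := (div_le_one (by positivity)).2 (by linarith)
      have := basicNhd_comp (by linarith) hxy' hyz'
      rwa [mul_div_cancel₀ _ two_ne_zero] at this)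

theorem entourageBasis_hasBasis :
    (uniformCore (E := E)).uniformity.HasBasis (fun _ : ℕ => True) entourage := by
  have := (entourageBasis (E := E)).hasBasis
  refine ⟨fun t => (this.mem_iff).trans ⟨?_, ?_⟩⟩
  · rintro ⟨_, ⟨n, rfl⟩, h⟩
    exact ⟨n, trivial, h⟩
  · rintro ⟨n, -, h⟩
    exact ⟨_, ⟨n, rfl⟩, h⟩

/-- In both topologies a set is open when it contains a basic neighbourhood of each of its points,
and the choices `K = n`, `ε = 1 / (n + 1)` are cofinal among these. -/
theorem topology_eq :
    (inferInstance : TopologicalSpace (SkorokhodSpace E)) = uniformCore.toTopologicalSpace := by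
  apply TopologicalSpace.ext
  funext s
  apply propext
  change (∀ x ∈ s, ∃ K : ℝ≥0, ∃ ε > 0, x.basicNhd K ε ⊆ s) ↔
    IsOpen[uniformCore.toTopologicalSpace] s
  let _ := (uniformCore (E := E)).toTopologicalSpace
  rw [isOpen_iff_mem_nhds]
  refine forall₂_congr fun x hx => ?_
  rw [UniformSpace.Core.nhds_toTopologicalSpace, (entourageBasis_hasBasis.comap _).mem_iff]
  constructor
  · rintro ⟨K, ε, hε, h⟩
    obtain ⟨n, hn⟩ := exists_entourage_subset (E := E) K hε
    exact ⟨n, trivial, fun y hy => h (hn x y hy)⟩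
  · rintro ⟨n, -, h⟩
    exact ⟨n, 1 / (n + 1), by positivity, fun y hy => h hy⟩

/-- The `J₁` uniform structure, which induces the `J₁` topology. -/
abbrev uniformSpace : UniformSpace (SkorokhodSpace E) :=
  UniformSpace.ofCoreEq uniformCore _ topology_eq

section

attribute [local instance] uniformSpace

theorem uniformity_hasBasis :
    (uniformity (SkorokhodSpace E)).HasBasis (fun _ : ℕ => True) entourage :=
  entourageBasis_hasBasis

/-- Countable generation makes `J₁` pseudometrizable, so that Lipschitz test functions become
available. -/
theorem isCountablyGenerated_uniformity :
    (uniformity (SkorokhodSpace E)).IsCountablyGenerated :=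
  uniformity_hasBasis.isCountablyGenerated

theorem exists_basicNhd_of_mem_uniformity {V : Set (SkorokhodSpace E × SkorokhodSpace E)}
    (hV : V ∈ uniformity (SkorokhodSpace E)) :
    ∃ (K : ℕ) (ε : ℝ), 0 < ε ∧ ∀ x y : SkorokhodSpace E, y ∈ x.basicNhd K ε → (x, y) ∈ V := by
  obtain ⟨n, -, hn⟩ := uniformity_hasBasis.mem_iff.1 hV
  exact ⟨n, 1 / (n + 1), by positivity, fun x y h => hn h⟩

end

end SkorokhodSpace

/-! ### Piecewise linear changes of time -/

section TimeChange

/-- The order isomorphism of `[0,∞)` which is the identity up to `p` and has slope `s`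
afterwards. -/
noncomputable def kinkIso (p s : ℝ≥0) (hs : 0 < s) : ℝ≥0 ≃o ℝ≥0 where
  toFun u := min u p + s * (u - p)
  invFun u := min u p + s⁻¹ * (u - p)
  left_inv u := by
    rcases le_total u p with h | h
    · simp [h, tsub_eq_zero_of_le h]
    · have h1 : min (p + s * (u - p)) p = p := min_eq_right le_self_add
      simp only [min_eq_right h, h1, add_tsub_cancel_left, inv_mul_cancel_left₀ hs.ne']
      exact add_tsub_cancel_of_le h
  right_inv u := by
    rcases le_total u p with h | h
    · simp [h, tsub_eq_zero_of_le h]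
    · have h1 : min (p + s⁻¹ * (u - p)) p = p := min_eq_right le_self_add
      simp only [min_eq_right h, h1, add_tsub_cancel_left, mul_inv_cancel_left₀ hs.ne']
      exact add_tsub_cancel_of_le h
  map_rel_iff' := by
    intro u v
    simp only [Equiv.coe_fn_mk]
    have hmono : StrictMono fun u : ℝ≥0 => min u p + s * (u - p) := by
      intro u v huv
      rcases le_total u p with h | h
      · simp only [min_eq_left h, tsub_eq_zero_of_le h, mul_zero, add_zero]
        rcases le_total v p with h' | h'
        · simpa [min_eq_left h', tsub_eq_zero_of_le h'] using huv
        · rw [min_eq_right h']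
          rcases h.lt_or_eq with h'' | h''
          · exact h''.trans_le le_self_add
          · subst h''
            exact lt_add_of_pos_right _ (mul_pos hs (tsub_pos_of_lt huv))
      · simp only [min_eq_right h, min_eq_right (h.trans huv.le)]
        gcongr 1
        exact mul_lt_mul_of_pos_left (tsub_lt_tsub_right_of_le h huv) hs
    exact hmono.le_iff_le

theorem kinkIso_apply_of_le {p s : ℝ≥0} (hs : 0 < s) {u : ℝ≥0} (hu : u ≤ p) :
    kinkIso p s hs u = u := by
  change min u p + s * (u - p) = u
  simp [hu, tsub_eq_zero_of_le hu]

theorem exists_kinkIso {p c d : ℝ≥0} (hc : p < c) (hd : p < d) :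
    ∃ s hs, kinkIso p s hs c = d := by
  have hc' : 0 < c - p := tsub_pos_of_lt hc
  refine ⟨(d - p) / (c - p), div_pos (tsub_pos_of_lt hd) hc', ?_⟩
  change min c p + (d - p) / (c - p) * (c - p) = d
  rw [min_eq_right hc.le, div_mul_cancel₀ _ hc'.ne', add_tsub_cancel_of_le hd.le]

/-- Finite strictly increasing sequences can be matched by a change of time. -/
theorem exists_orderIso_apply_eq {a b : ℕ → ℝ≥0} (ha : StrictMono a) (hb : StrictMono b)
    (ha0 : a 0 = 0) (hb0 : b 0 = 0) (m : ℕ) :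
    ∃ Λ : ℝ≥0 ≃o ℝ≥0, ∀ l ≤ m, Λ (a l) = b l := by
  induction m with
  | zero =>
    refine ⟨OrderIso.refl _, fun l hl => ?_⟩
    obtain rfl := Nat.le_zero.1 hl
    simp [ha0, hb0]
  | succ m ih =>
    obtain ⟨Λ, hΛ⟩ := ih
    have h1 : b m < Λ (a (m + 1)) := by
      rw [← hΛ m le_rfl]
      exact Λ.strictMono (ha m.lt_succ_self)
    obtain ⟨s, hs, h⟩ := exists_kinkIso h1 (hb m.lt_succ_self)
    -- The correction is the identity up to `b m`, so the values already matched are kept.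
    refine ⟨Λ.trans (kinkIso (b m) s hs), fun l hl => ?_⟩
    rcases Nat.le_succ_iff.1 hl with hl | rfl
    · rw [OrderIso.trans_apply, hΛ l hl, kinkIso_apply_of_le hs (hb.monotone hl)]
    · exact h

end TimeChange

/-! ### Running suprema of marked points and their `J₁` approximation -/

section SupPath

variable {T : Type*} [MetricSpace T] [CompactSpace T]

theorem apply_le_supNorm (x : CPlus T) (t : T) : x t ≤ supNorm x := by
  have := ContinuousMap.dist_apply_le_dist (f := x) (g := 0) t
  rw [← NNReal.coe_le_coe, supNorm, coe_nndist]
  simpa [NNReal.dist_eq] using this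

theorem dist_le_of_isLUB {A B : Set ℝ≥0} {a b ε : ℝ≥0} (hA : IsLUB A a) (hB : IsLUB B b)
    (h : ∀ r ∈ A, r ≤ b + ε) (h' : ∀ r ∈ B, r ≤ a + ε) : dist a b ≤ ε := by
  have h1 : a ≤ b + ε := hA.2 h
  have h2 : b ≤ a + ε := hB.2 h'
  rw [NNReal.dist_eq, abs_le]
  have h3 : (a : ℝ) ≤ b + ε := by exact_mod_cast h1
  have h4 : (b : ℝ) ≤ a + ε := by exact_mod_cast h2
  constructor <;> linarith

variable {I : Type*} {Y : I → CPlus T} {U : I → ℝ≥0}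

/-- Pointwise suprema of families of continuous functions, finitely many of which exceed any given
level, are continuous. -/
theorem exists_continuousMap_isLUB (J : Set I)
    (hJ : ∀ ε : ℝ≥0, 0 < ε → {i ∈ J | ε ≤ supNorm (Y i)}.Finite) :
    ∃ g : CPlus T, ∀ t, IsLUB ((fun i => Y i t) '' J) (g t) := by
  have hbdd : ∀ t, BddAbove ((fun i => Y i t) '' J) := by
    intro t
    obtain ⟨b, hb⟩ := ((hJ 1 one_pos).image fun i => Y i t).bddAbove
    refine ⟨max b 1, ?_⟩
    rintro _ ⟨i, hi, rfl⟩
    by_cases h : 1 ≤ supNorm (Y i)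
    · exact (hb ⟨i, ⟨hi, h⟩, rfl⟩).trans (le_max_left _ _)
    · exact ((apply_le_supNorm _ t).trans (not_le.1 h).le).trans (le_max_right _ _)
  have hlub : ∀ t, IsLUB ((fun i => Y i t) '' J) (sSup ((fun i => Y i t) '' J)) := by
    intro t
    rcases ((fun i => Y i t) '' J).eq_empty_or_nonempty with h | h
    · rw [h, csSup_empty]
      exact isLUB_empty
    · exact isLUB_csSup h (hbdd t)
  refine ⟨⟨fun t => sSup ((fun i => Y i t) '' J), ?_⟩, hlub⟩
  -- Dropping the functions of norm below `ε / 2` changes the supremum by at most `ε / 2` and leaves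
  -- a finite one.
  apply continuous_of_uniform_approx_of_continuous
  intro V hV
  obtain ⟨ε, hε, hV⟩ := Metric.mem_uniformity_dist.1 hV
  let ε' : ℝ≥0 := ⟨ε / 2, (half_pos hε).le⟩
  have hε' : 0 < ε' := half_pos hε
  refine ⟨fun t => (hJ ε' hε').toFinset.sup fun i => Y i t, ?_, fun t => hV ?_⟩
  · exact Continuous.finset_sup_apply fun i _ => (Y i).continuous
  · refine lt_of_le_of_lt ?_ (half_lt_self hε)
    have hs : IsLUB ((fun i => Y i t) '' {i ∈ J | ε' ≤ supNorm (Y i)})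
        ((hJ ε' hε').toFinset.sup fun i => Y i t) := by
      have := Finset.isLUB_sup (s := (hJ ε' hε').toFinset) (f := fun i => Y i t)
      simpa using this
    refine dist_le_of_isLUB (ε := ε') (hlub t) hs ?_ ?_
    · rintro _ ⟨i, hi, rfl⟩
      by_cases h : ε' ≤ supNorm (Y i)
      · exact (hs.1 ⟨i, ⟨hi, h⟩, rfl⟩).trans le_self_add
      · exact ((apply_le_supNorm _ t).trans (not_le.1 h).le).trans le_add_self
    · rintro _ ⟨i, hi, rfl⟩
      exact ((hlub t).1 ⟨i, hi.1, rfl⟩).trans le_self_add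

theorem dist_le_of_isLUB_of_subset {J J' : Set I} {g g' : CPlus T} {ε : ℝ≥0}
    (hg : ∀ t, IsLUB ((fun i => Y i t) '' J) (g t))
    (hg' : ∀ t, IsLUB ((fun i => Y i t) '' J') (g' t))
    (hJ : J ⊆ J') (h : ∀ i ∈ J', i ∉ J → supNorm (Y i) ≤ ε) : dist g g' ≤ ε := by
  rw [ContinuousMap.dist_le ε.coe_nonneg]
  intro t
  refine dist_le_of_isLUB (hg t) (hg' t) ?_ ?_
  · rintro _ ⟨i, hi, rfl⟩
    exact ((hg' t).1 ⟨i, hJ hi, rfl⟩).trans le_self_add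
  · rintro _ ⟨i, hi, rfl⟩
    by_cases hi' : i ∈ J
    · exact ((hg t).1 ⟨i, hi', rfl⟩).trans le_self_add
    · exact ((apply_le_supNorm _ t).trans (h i hi hi')).trans le_add_self

/-- The path `x` is the running supremum `x(u) = sup {Y i : U i ≤ u}`. -/
def IsSupPath (Y : I → CPlus T) (U : I → ℝ≥0) (x : SkorokhodSpace (CPlus T)) : Prop :=
  ∀ u t, IsLUB ((fun i => Y i t) '' {i | U i ≤ u}) (x u t)

/-- Only finitely many of the points `(Y i, U i)` lie in any bounded set. -/
def LocallyFinitePoints (Y : I → CPlus T) (U : I → ℝ≥0) : Prop :=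
  ∀ ε : ℝ≥0, 0 < ε → ∀ K, {i | ε ≤ supNorm (Y i) ∧ U i ≤ K}.Finite

/-- Up to an error `ε / 2` only finitely many points count near a time `u`, and none of them has its
time in `(u, v]` for `v` close to `u`. The left limit is the supremum over the points with time
strictly before `u`. -/
theorem LocallyFinitePoints.exists_isSupPath (hfin : LocallyFinitePoints Y U) :
    ∃ x, IsSupPath Y U x := by
  have hle : ∀ u, ∃ g : CPlus T, ∀ t, IsLUB ((fun i => Y i t) '' {i | U i ≤ u}) (g t) :=
    fun u => exists_continuousMap_isLUB _ fun ε hε =>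
      (hfin ε hε u).subset fun i hi => ⟨hi.2, hi.1⟩
  have hlt : ∀ u, ∃ g : CPlus T, ∀ t, IsLUB ((fun i => Y i t) '' {i | U i < u}) (g t) :=
    fun u => exists_continuousMap_isLUB _ fun ε hε =>
      (hfin ε hε u).subset fun i hi => ⟨hi.2, le_of_lt hi.1⟩
  choose x hx using hle
  refine ⟨⟨x, fun u => ?_, fun u => ?_⟩, hx⟩
  · refine Metric.tendsto_nhds.2 fun ε hε => ?_
    have hε' : (0 : ℝ≥0) < ⟨ε / 2, (half_pos hε).le⟩ := half_pos hε
    have h1 : ∀ᶠ v in 𝓝[≥] u, ∀ i ∈ {i | ⟨ε / 2, (half_pos hε).le⟩ ≤ supNorm (Y i) ∧ U i ≤ u + 1},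
        u < U i → v < U i := by
      rw [eventually_all_finite (hfin _ hε' (u + 1))]
      intro i _
      by_cases hi : u < U i
      · filter_upwards [mem_nhdsWithin_of_mem_nhds (Iio_mem_nhds hi)] with v hv _ using hv
      · exact Eventually.of_forall fun v hv => absurd hv hi
    have h2 : ∀ᶠ v in 𝓝[≥] u, v < u + 1 :=
      mem_nhdsWithin_of_mem_nhds (Iio_mem_nhds (lt_add_one u))
    filter_upwards [h1, h2, self_mem_nhdsWithin] with v hv1 hv2 hv3
    refine lt_of_le_of_lt ?_ (half_lt_self hε)
    rw [dist_comm]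
    refine dist_le_of_isLUB_of_subset (ε := ⟨ε / 2, (half_pos hε).le⟩) (hx u) (hx v)
      (fun i (hi : U i ≤ u) => hi.trans hv3) fun i hi hi' => ?_
    by_contra hn
    exact absurd (hv1 i ⟨(not_le.1 hn).le, le_trans hi hv2.le⟩ (not_le.1 hi')) (not_lt.2 hi)
  · obtain ⟨l, hl⟩ := hlt u
    refine ⟨l, Metric.tendsto_nhds.2 fun ε hε => ?_⟩
    have hε' : (0 : ℝ≥0) < ⟨ε / 2, (half_pos hε).le⟩ := half_pos hε
    have h1 : ∀ᶠ v in 𝓝[<] u, ∀ i ∈ {i | ⟨ε / 2, (half_pos hε).le⟩ ≤ supNorm (Y i) ∧ U i ≤ u},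
        U i < u → U i < v := by
      rw [eventually_all_finite (hfin _ hε' u)]
      intro i _
      by_cases hi : U i < u
      · filter_upwards [mem_nhdsWithin_of_mem_nhds (Ioi_mem_nhds hi)] with v hv _ using hv
      · exact Eventually.of_forall fun v hv => absurd hv hi
    filter_upwards [h1, self_mem_nhdsWithin] with v hv1 hv2
    refine lt_of_le_of_lt ?_ (half_lt_self hε)
    refine dist_le_of_isLUB_of_subset (ε := ⟨ε / 2, (half_pos hε).le⟩) (hx v) hl
      (fun i (hi : U i ≤ v) => hi.trans_lt hv2) fun i hi hi' => ?_
    by_contra hn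
    exact hi' (hv1 i ⟨(not_le.1 hn).le, le_of_lt hi⟩ hi).le

/-- The slab `(l h, (l + 1) h]` of the time axis. -/
def timeSlab (h : ℝ≥0) (l : ℕ) : Set ℝ≥0 := Ioc (l * h) ((l + 1) * h)

theorem exists_mem_timeSlab {h : ℝ≥0} {L : ℕ} {u : ℝ≥0} (hu : 0 < u) (hL : u ≤ L * h) :
    ∃ l < L, u ∈ timeSlab h l := by
  induction L with
  | zero => simp [hu.ne'] at hL
  | succ L ih =>
    by_cases hu' : u ≤ L * h
    · obtain ⟨l, hl, h'⟩ := ih hu'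
      exact ⟨l, hl.trans L.lt_succ_self, h'⟩
    · exact ⟨L, L.lt_succ_self, not_le.1 hu', by exact_mod_cast hL⟩

theorem exists_first_time (hfin : LocallyFinitePoints Y U) {h ε : ℝ≥0} (hh : 0 < h) (hε : 0 < ε)
    (l : ℕ) : ∃ σ ∈ timeSlab h l, (∀ i, ε ≤ supNorm (Y i) → U i ∈ timeSlab h l → σ ≤ U i ∧
      ∃ k, ε ≤ supNorm (Y k) ∧ U k ∈ timeSlab h l ∧ U k = σ) := by
  by_cases hne : {i | ε ≤ supNorm (Y i) ∧ U i ∈ timeSlab h l}.Nonempty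
  · have hf : {i | ε ≤ supNorm (Y i) ∧ U i ∈ timeSlab h l}.Finite :=
      (hfin ε hε ((l + 1) * h)).subset fun i hi => ⟨hi.1, hi.2.2⟩
    obtain ⟨k, hk, hmin⟩ := exists_min_image _ U hf hne
    exact ⟨U k, hk.2, fun i h1 h2 => ⟨hmin i ⟨h1, h2⟩, k, hk.1, hk.2, rfl⟩⟩
  -- In a slab without exceedance the right end serves as default, so that there is one node per
  -- slab and the nodes stay strictly increasing.
  · refine ⟨(l + 1) * h, ⟨?_, le_rfl⟩, fun i h1 h2 => absurd ⟨i, h1, h2⟩ hne⟩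
    gcongr
    exact lt_add_one _

/-- A path is determined, up to a small `J₁`-distance, by the set of the occupied cells
`A j × timeSlab h l`, as long as there is at most one occupied cell in each time slab. -/
theorem IsSupPath.mem_basicNhd {x z : SkorokhodSpace (CPlus T)} (hx : IsSupPath Y U x)
    (hfin : LocallyFinitePoints Y U) {J : Type*} {A : J → Set (CPlus T)} {y : J → CPlus T}
    {bad : J} {ε h : ℝ≥0} (hε : 0 < ε) (hh : 0 < h)
    (hU : ∀ i, ε ≤ supNorm (Y i) → 0 < U i)
    (hcover : ∀ w, (∃ j, w ∈ A j) ↔ ε ≤ supNorm w) {δ : ℝ≥0} (hεδ : ε ≤ δ)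
    (hA : ∀ j, j ≠ bad → ∀ w ∈ A j, dist w (y j) ≤ δ) {L : ℕ}
    {S : Set (J × Fin L)} (hS : ∀ s, s ∈ S ↔ ∃ i, Y i ∈ A s.1 ∧ U i ∈ timeSlab h s.2)
    (hgood : ∀ s ∈ S, s.1 ≠ bad ∧ ∀ s' ∈ S, s'.2 = s.2 → s' = s)
    (hz : IsSupPath (fun s : S => y s.1.1) (fun s : S => (s.1.2 + 1) * h) z)
    {K : ℝ≥0} (hK : K ≤ L * h) : x ∈ z.basicNhd K (max δ (2 * h)) := by
  choose σ hσ hσ' using exists_first_time hfin hh hε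
  -- In slab `l` the path `z` jumps at `(l + 1) * h`, while the first large jump time of `x` is `σ
  -- l`; the time change carries the second to the first. The index shift makes room for the fixed
  -- point `0`.
  let a : ℕ → ℝ≥0 := fun l => Nat.casesOn l 0 σ
  let b : ℕ → ℝ≥0 := fun l => l * h
  have ha : StrictMono a := by
    refine strictMono_nat_of_lt_succ fun l => ?_
    cases l with
    | zero => exact lt_of_le_of_lt (zero_le) (hσ 0).1
    | succ l =>
      refine lt_of_le_of_lt (hσ l).2 ?_
      have := (hσ (l + 1)).1
      push_cast at this
      exact this
  have hb : StrictMono b := fun l m hlm => by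
    have : (l : ℝ≥0) < m := by exact_mod_cast hlm
    change (l : ℝ≥0) * h < m * h
    gcongr
  -- One node beyond the last slab is matched, because `σ L` is the first node known to exceed every
  -- time up to `L * h`.
  obtain ⟨Λ, hΛ⟩ := exists_orderIso_apply_eq ha hb rfl (by simp [b]) (L + 1)
  have hΛσ : ∀ l ≤ L, Λ (σ l) = (l + 1) * h := fun l hl => by
    have := hΛ (l + 1) (by omega)
    simpa [a, b] using this
  refine ⟨Λ, fun u hu => ⟨le_trans ?_ (le_max_right _ _), le_trans ?_ (le_max_left _ _)⟩⟩
  -- If `a l ≤ u < a (l + 1)`, then `Λ u` lies in `[l h, (l + 1) h)` and `u` between `(l - 1) h` and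
  -- `(l + 1) h`; hence the displacement is at most `2 * h`.
  · have hex : ∃ l, u < a (l + 1) := ⟨L, (hu.trans hK).trans_lt (hσ L).1⟩
    obtain ⟨l, hl1, hl2, hlL⟩ : ∃ l, a l ≤ u ∧ u < a (l + 1) ∧ l ≤ L := by
      classical
      refine ⟨Nat.find hex, ?_, Nat.find_spec hex, Nat.find_min' hex
        ((hu.trans hK).trans_lt (hσ L).1)⟩
      rcases hl : Nat.find hex with _ | k
      · exact zero_le
      · exact not_lt.1 (Nat.find_min hex (by omega : k < Nat.find hex))
    have h1 : b l ≤ Λ u := by rw [← hΛ l (by omega)]; exact Λ.monotone hl1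
    have h2 : Λ u < b (l + 1) := by
      rw [← hΛ (l + 1) (by omega)]; exact Λ.strictMono hl2
    have h3 : u ≤ b (l + 1) := hl2.le.trans (by simpa [b] using (hσ l).2)
    have h4 : b l ≤ u + h := by
      rcases l with _ | k
      · simp [b]
      · have : (k : ℝ≥0) * h ≤ u := (hσ k).1.le.trans hl1
        calc b (k + 1) = k * h + h := by simp [b, add_mul]
          _ ≤ u + h := by gcongr
    have h5 : (b (l + 1) : ℝ) = b l + h := by simp [b, add_mul]
    have h1' : (b l : ℝ) ≤ Λ u := h1
    have h2' : (Λ u : ℝ) < b (l + 1) := h2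
    have h3' : (u : ℝ) ≤ b (l + 1) := h3
    have h4' : (b l : ℝ) ≤ u + h := h4
    rw [NNReal.dist_eq, abs_le]
    have hh' : (0 : ℝ) ≤ h := h.2
    constructor <;> linarith
  · rw [ContinuousMap.dist_le δ.coe_nonneg]
    intro t
    have hval : ∀ {v w : CPlus T}, dist v w ≤ δ → v t ≤ w t + δ ∧ w t ≤ v t + δ := by
      intro v w hvw
      have := (ContinuousMap.dist_apply_le_dist (f := v) (g := w) t).trans hvw
      rw [NNReal.dist_eq, abs_le] at this
      constructor
      · rw [← NNReal.coe_le_coe]; push_cast; linarith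
      · rw [← NNReal.coe_le_coe]; push_cast; linarith
    refine dist_le_of_isLUB (hx u t) (hz (Λ u) t) ?_ ?_
    -- A large point counted by `x` at time `u` satisfies `σ l ≤ U i ≤ u`, so `z` has already jumped
    -- at time `Λ u`.
    · rintro _ ⟨i, hi, rfl⟩
      by_cases hi' : ε ≤ supNorm (Y i)
      · obtain ⟨j, hj⟩ := (hcover _).2 hi'
        have hi : U i ≤ u := hi
        obtain ⟨l, hl, hil⟩ := exists_mem_timeSlab (hU i hi') ((hi.trans hu).trans hK)
        have hmem : (j, (⟨l, hl⟩ : Fin L)) ∈ S := (hS _).2 ⟨i, hj, hil⟩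
        have hle : (l + 1) * h ≤ Λ u := by
          rw [← hΛσ l hl.le]
          exact Λ.monotone ((hσ' l i hi' hil).1.trans hi)
        refine (hval (hA j (hgood _ hmem).1 _ hj)).1.trans ?_
        gcongr
        exact (hz (Λ u) t).1 ⟨⟨_, hmem⟩, hle, rfl⟩
      · exact ((apply_le_supNorm _ t).trans ((not_le.1 hi').le.trans hεδ)).trans le_add_self
    -- Conversely, if `z` has made its jump by `Λ u`, the first exceedance in that slab has occurred
    -- by `u`; it may be a different point, but it lies in the only occupied cell of the slab.
    · rintro _ ⟨⟨⟨j, l⟩, hs⟩, hle, rfl⟩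
      obtain ⟨i, hiA, hil⟩ := (hS _).1 hs
      obtain ⟨k, hk, hkl, hkσ⟩ := (hσ' l i ((hcover _).1 ⟨j, hiA⟩) hil).2
      obtain ⟨j', hj'⟩ := (hcover _).2 hk
      have hmem : (j', l) ∈ S := (hS _).2 ⟨k, hj', hkl⟩
      obtain rfl : j' = j := congrArg Prod.fst ((hgood _ hs).2 _ hmem rfl)
      have hku : U k ≤ u := by
        have hle : ((l : ℕ) + 1 : ℝ≥0) * h ≤ Λ u := hle
        rw [hkσ, ← Λ.le_iff_le, hΛσ l l.2.le]
        exact hle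
      refine (hval (hA j' (hgood _ hs).1 _ hj')).2.trans ?_
      gcongr
      exact (hx u t).1 ⟨k, hku, rfl⟩

end SupPath

/-! ### Weak convergence from finitely valued approximations -/

section Discretization

theorem aemeasurable_comp_of_finite {Ω F D : Type*} [MeasurableSpace Ω] [MeasurableSpace D]
    [Finite F] {μ : Measure Ω} {ξ : Ω → F} (hξ : ∀ S, NullMeasurableSet {ω | ξ ω = S} μ)
    (z : F → D) : AEMeasurable (fun ω => z (ξ ω)) μ := by
  let _ : MeasurableSpace F := ⊤
  have h : NullMeasurable ξ μ := by
    intro s _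
    have : ξ ⁻¹' s = ⋃ S ∈ s, {ω | ξ ω = S} := by ext; simp
    rw [this]
    exact NullMeasurableSet.biUnion s.to_countable fun S _ => hξ S
  exact (measurable_from_top (f := z)).comp_aemeasurable h.aemeasurable

theorem integral_comp_eq_sum {Ω F : Type*} [MeasurableSpace Ω] [Fintype F] {μ : Measure Ω}
    [IsProbabilityMeasure μ] {ξ : Ω → F} (hξ : ∀ S, NullMeasurableSet {ω | ξ ω = S} μ)
    (g : F → ℝ) : ∫ ω, g (ξ ω) ∂μ = ∑ S, μ.real {ω | ξ ω = S} * g S := by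
  let _ : MeasurableSpace F := ⊤
  have hm : AEMeasurable ξ μ := aemeasurable_comp_of_finite hξ id
  have : IsProbabilityMeasure (μ.map ξ) := Measure.isProbabilityMeasure_map hm
  rw [← integral_map (f := g) hm (measurable_from_top (f := g)).aestronglyMeasurable,
    integral_fintype Integrable.of_finite]
  refine Finset.sum_congr rfl fun S _ => ?_
  rw [map_measureReal_apply_of_aemeasurable hm (MeasurableSet.singleton S), smul_eq_mul]
  rfl

/-- On `G` the Lipschitz property costs `B * δ`; off `G` the oscillation `C` of `f` is paid with the
probability of leaving `G`. -/
theorem abs_integral_sub_integral_le {Ω F D : Type*} [MeasurableSpace Ω] [Finite F]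
    [PseudoMetricSpace D] [MeasurableSpace D] [BorelSpace D] {μ : Measure Ω}
    [IsProbabilityMeasure μ] {ξ : Ω → F} (hξ : ∀ S, NullMeasurableSet {ω | ξ ω = S} μ)
    {X : Ω → D} (hX : AEMeasurable X μ) {G : Set F} {z : F → D} {δ : ℝ} (hδ : 0 ≤ δ)
    (hG : ∀ᵐ ω ∂μ, ξ ω ∈ G → dist (X ω) (z (ξ ω)) ≤ δ) {f : D → ℝ} {C : ℝ} {B : ℝ≥0}
    (hC : ∀ x y, dist (f x) (f y) ≤ C) (hf : LipschitzWith B f) :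
    |∫ ω, f (X ω) ∂μ - ∫ ω, f (z (ξ ω)) ∂μ| ≤
      B * δ + C * ∫ ω, Gᶜ.indicator (fun _ => (1 : ℝ)) (ξ ω) ∂μ := by
  have hbdd : ∃ b, ∀ x, |f x| ≤ b := by
    rcases isEmpty_or_nonempty D with h | ⟨⟨x0⟩⟩
    · exact ⟨0, fun x => h.elim x⟩
    · refine ⟨|f x0| + C, fun x => ?_⟩
      have := hC x x0
      rw [Real.dist_eq] at this
      linarith [abs_sub_abs_le_abs_sub (f x) (f x0)]
  obtain ⟨b, hb⟩ := hbdd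
  have i1 : Integrable (fun ω => f (X ω)) μ :=
    Integrable.of_bound (hf.continuous.measurable.comp_aemeasurable hX).aestronglyMeasurable b
      (Eventually.of_forall fun ω => hb _)
  have i2 : Integrable (fun ω => f (z (ξ ω))) μ :=
    Integrable.of_bound (aemeasurable_comp_of_finite hξ fun S => f (z S)).aestronglyMeasurable b
      (Eventually.of_forall fun ω => hb _)
  have i3 : Integrable (fun ω => Gᶜ.indicator (fun _ => (1 : ℝ)) (ξ ω)) μ := by
    refine Integrable.of_bound (aemeasurable_comp_of_finite hξ _).aestronglyMeasurable 1
      (Eventually.of_forall fun ω => ?_)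
    by_cases h : ξ ω ∈ Gᶜ <;> simp [h]
  rw [← integral_sub i1 i2]
  calc |∫ ω, (f (X ω) - f (z (ξ ω))) ∂μ| ≤ ∫ ω, |f (X ω) - f (z (ξ ω))| ∂μ :=
        abs_integral_le_integral_abs
    _ ≤ ∫ ω, (B * δ + C * Gᶜ.indicator (fun _ => (1 : ℝ)) (ξ ω)) ∂μ := by
        refine integral_mono_ae (i1.sub i2).abs ((integrable_const _).add (i3.const_mul C)) ?_
        filter_upwards [hG] with ω hω
        change dist (f (X ω)) (f (z (ξ ω))) ≤ _
        by_cases h : ξ ω ∈ G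
        · have : ξ ω ∉ Gᶜ := fun h' => h' h
          rw [indicator_of_notMem this, mul_zero, add_zero]
          exact (hf.dist_le_mul _ _).trans (mul_le_mul_of_nonneg_left (hω h) B.2)
        · have h' : ξ ω ∈ Gᶜ := h
          rw [indicator_of_mem h', mul_one]
          exact (hC _ _).trans (le_add_of_nonneg_left (mul_nonneg B.2 hδ))
    _ = _ := by
        rw [integral_add (integrable_const _) (i3.const_mul C), integral_const_mul C,
          integral_const, probReal_univ, one_smul]

/-- Random elements which are, for every `δ > 0`, approximated up to `δ` outside of an event of
probability at most `δ` by functions of finitely valued random variables with converging laws. -/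
def FinitelyApproximable {Ω : ℕ → Type*} [∀ n, MeasurableSpace (Ω n)] (P : ∀ n, Measure (Ω n))
    {Ω' : Type*} [MeasurableSpace Ω'] (P' : Measure Ω') {D : Type*} (close : ℝ → D → D → Prop)
    (X : ∀ n, Ω n → D) (X' : Ω' → D) : Prop :=
  ∀ δ : ℝ, 0 < δ → ∃ (F : Type) (_ : Finite F) (ξ : ∀ n, Ω n → F) (ξ' : Ω' → F) (G : Set F)
    (z : F → D), (∀ n S, NullMeasurableSet {ω | ξ n ω = S} (P n)) ∧
      (∀ S, NullMeasurableSet {ω | ξ' ω = S} P') ∧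
      (∀ S, Tendsto (fun n => (P n).real {ω | ξ n ω = S}) atTop (𝓝 (P'.real {ω | ξ' ω = S}))) ∧
      P' {ω | ξ' ω ∉ G} ≤ ENNReal.ofReal δ ∧
      (∀ᶠ n in atTop, ∀ᵐ ω ∂(P n), ξ n ω ∈ G → close δ (X n ω) (z (ξ n ω))) ∧
      (∀ᵐ ω ∂P', ξ' ω ∈ G → close δ (X' ω) (z (ξ' ω)))

section

variable {Ω : ℕ → Type*} [∀ n, MeasurableSpace (Ω n)] {P : ∀ n, Measure (Ω n)}
  {Ω' : Type*} [MeasurableSpace Ω'] {P' : Measure Ω'} {D : Type*}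
  [PseudoMetricSpace D] [MeasurableSpace D] [BorelSpace D] {X : ∀ n, Ω n → D} {X' : Ω' → D}

/-- With `δ = 2⁻ⁿ` the exceptional probabilities are summable, so by Borel–Cantelli `X'` is almost
everywhere a limit of finitely valued measurable variables. -/
theorem FinitelyApproximable.aemeasurable_limit
    (H : FinitelyApproximable P P' (fun δ x y => dist x y ≤ δ) X X') : AEMeasurable X' P' := by
  have hδ : ∀ n : ℕ, (0 : ℝ) < (1 / 2) ^ n := fun n => by positivity
  choose F hF ξ ξ' G z _ hξ' _ hG _ hclose using fun n : ℕ => H _ (hδ n)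
  refine aemeasurable_of_tendsto_metrizable_ae' (f := fun n ω => z n (ξ' n ω))
    (fun n => aemeasurable_comp_of_finite (hξ' n) (z n)) ?_
  have hsum : ∑' n, P' {ω | ξ' n ω ∉ G n} ≠ ∞ := by
    refine ne_top_of_le_ne_top ?_ (ENNReal.tsum_le_tsum hG)
    rw [← ENNReal.ofReal_tsum_of_nonneg (fun n => (hδ n).le) summable_geometric_two]
    exact ENNReal.ofReal_ne_top
  filter_upwards [ae_eventually_notMem hsum, ae_all_iff.2 hclose] with ω h1 h2
  rw [tendsto_iff_dist_tendsto_zero]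
  refine squeeze_zero' (Eventually.of_forall fun _ => dist_nonneg) ?_
    (tendsto_pow_atTop_nhds_zero_of_lt_one (r := (1 / 2 : ℝ)) (by norm_num) (by norm_num))
  filter_upwards [h1] with n hn
  rw [dist_comm]
  exact h2 n (not_not.1 hn)

/-- Expectations of functions of `ξ n` are finite sums and converge. This handles both the term
comparing `z (ξ n)` with `z (ξ')` and the probability that `ξ n` leaves `G`, whose limit is at most
`δ`. -/
theorem FinitelyApproximable.tendstoInDistribution
    [∀ n, IsProbabilityMeasure (P n)] [IsProbabilityMeasure P'] (hX : ∀ n, AEMeasurable (X n) (P n))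
    (H : FinitelyApproximable P P' (fun δ x y => dist x y ≤ δ) X X') :
    TendstoInDistribution X atTop X' P P' := by
  have hX' := H.aemeasurable_limit
  refine ⟨hX, hX', ?_⟩
  refine tendsto_iff_forall_lipschitz_integral_tendsto.2 ?_
  rintro f ⟨C, hC⟩ ⟨B, hf⟩
  have hfm : Measurable f := hf.continuous.measurable
  simp only [ProbabilityMeasure.coe_mk]
  simp_rw [integral_map (hX _) hfm.aestronglyMeasurable,
    integral_map hX' hfm.aestronglyMeasurable]
  rw [Metric.tendsto_nhds]
  intro η hη
  have hC0 : 0 ≤ C := by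
    obtain ⟨ω⟩ : Nonempty Ω' := nonempty_of_isProbabilityMeasure P'
    exact dist_nonneg.trans (hC (X' ω) (X' ω))
  -- The factor `2` accounts for the two comparisons, for `X n` and for `X'`.
  obtain ⟨δ, hδ, hδη⟩ : ∃ δ : ℝ, 0 < δ ∧ 2 * (B * δ + C * δ) < η := by
    refine ⟨η / (4 * (B + C + 1)), by positivity, ?_⟩
    have : 0 < (B : ℝ) + C + 1 := by positivity
    rw [← add_mul, ← mul_assoc, mul_div_assoc', div_lt_iff₀ (by positivity)]
    nlinarith
  obtain ⟨F, hF, ξ, ξ', G, z, hξ, hξ', hlim, hG, hn, h'⟩ := H δ hδ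
  have := Fintype.ofFinite F
  have hconv : ∀ g : F → ℝ, Tendsto (fun n => ∫ ω, g (ξ n ω) ∂(P n)) atTop
      (𝓝 (∫ ω, g (ξ' ω) ∂P')) := by
    intro g
    simp_rw [integral_comp_eq_sum (hξ _), integral_comp_eq_sum hξ']
    exact tendsto_finsetSum _ fun S _ => (hlim S).mul_const _
  have hGc : ∫ ω, Gᶜ.indicator (fun _ => (1 : ℝ)) (ξ' ω) ∂P' ≤ δ := by
    have hm : NullMeasurableSet {ω | ξ' ω ∉ G} P' := by
      have : {ω | ξ' ω ∉ G} = ⋃ S ∈ Gᶜ, {ω | ξ' ω = S} := by ext; simp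
      rw [this]
      exact NullMeasurableSet.biUnion (Gᶜ).to_countable fun S _ => hξ' S
    have : (fun ω => Gᶜ.indicator (fun _ => (1 : ℝ)) (ξ' ω)) =
        {ω | ξ' ω ∉ G}.indicator (fun _ => (1 : ℝ)) := rfl
    rw [this, integral_indicator₀ hm, setIntegral_const, smul_eq_mul, mul_one]
    exact ENNReal.toReal_le_of_le_ofReal hδ.le hG
  have e2 := abs_integral_sub_integral_le hξ' hX' hδ.le h' hC hf
  have l1 := hconv fun S => f (z S)
  have l2 := hconv (Gᶜ.indicator fun _ => (1 : ℝ))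
  have l3 : Tendsto (fun n => (B * δ + C * ∫ ω, Gᶜ.indicator (fun _ => (1 : ℝ)) (ξ n ω) ∂(P n)) +
      |∫ ω, f (z (ξ n ω)) ∂(P n) - ∫ ω, f (z (ξ' ω)) ∂P'| +
      (B * δ + C * ∫ ω, Gᶜ.indicator (fun _ => (1 : ℝ)) (ξ' ω) ∂P')) atTop
      (𝓝 ((B * δ + C * ∫ ω, Gᶜ.indicator (fun _ => (1 : ℝ)) (ξ' ω) ∂P') + |0| +
        (B * δ + C * ∫ ω, Gᶜ.indicator (fun _ => (1 : ℝ)) (ξ' ω) ∂P'))) :=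
    (((l2.const_mul C).const_add _).add (tendsto_sub_nhds_zero_iff.2 l1).abs).add_const _
  have hlt : (B * δ + C * ∫ ω, Gᶜ.indicator (fun _ => (1 : ℝ)) (ξ' ω) ∂P') + |0| +
        (B * δ + C * ∫ ω, Gᶜ.indicator (fun _ => (1 : ℝ)) (ξ' ω) ∂P') < η := by
    have := mul_le_mul_of_nonneg_left hGc hC0
    rw [abs_zero]
    linarith
  filter_upwards [hn, l3.eventually_lt_const hlt] with n hn1 hn2
  have e1 := abs_integral_sub_integral_le (hξ n) (hX n) hδ.le hn1 hC hf
  rw [Real.dist_eq]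
  refine lt_of_le_of_lt ?_ hn2
  rw [abs_sub_comm] at e2
  exact (abs_sub_le _ (∫ ω, f (z (ξ' ω)) ∂P') _).trans
    (add_le_add ((abs_sub_le _ (∫ ω, f (z (ξ n ω)) ∂(P n)) _).trans (add_le_add e1 le_rfl)) e2)

end

/-- The event `ξ ⊆ S` splits according to the value of `ξ`; isolating the value `S` gives a
recursion along strict inclusion, which replaces Möbius inversion. -/
theorem measureReal_eq_sub_sum {Ω κ : Type*} [Finite κ] [Fintype (Set κ)] [MeasurableSpace Ω]
    (μ : Measure Ω) [IsProbabilityMeasure μ] {ξ : Ω → Set κ}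
    (hξ : ∀ S, NullMeasurableSet {ω | ξ ω = S} μ) (s : Finset (Set κ)) (S : Set κ)
    (hs : ∀ R, R ∈ s ↔ R ⊂ S) :
    μ.real {ω | ξ ω = S} = μ.real {ω | ξ ω ⊆ S} - ∑ R ∈ s, μ.real {ω | ξ ω = R} := by
  classical
  have hu : {ω | ξ ω ⊆ S} = ⋃ R ∈ insert S s, {ω | ξ ω = R} := by
    ext ω
    simp only [Finset.mem_insert, mem_iUnion, hs, mem_ofPred_eq, exists_prop, exists_eq_right']
    exact le_iff_eq_or_lt
  rw [hu, measureReal_biUnion_finset₀ _ (fun R _ => hξ R), Finset.sum_insert]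
  · ring
  · rw [hs]
    exact fun h => h.ne rfl
  · intro R _ R' _ hne
    refine Disjoint.aedisjoint (Set.disjoint_left.2 ?_)
    rintro ω (h1 : ξ ω = R) (h2 : ξ ω = R')
    exact hne (h1.symm.trans h2)

/-- If all probabilities `P (ξ ⊆ S)` converge, then the laws of the random sets `ξ` converge. -/
theorem tendsto_measureReal_eq_of_subset {Ω : ℕ → Type*} [∀ n, MeasurableSpace (Ω n)]
    {P : ∀ n, Measure (Ω n)} [∀ n, IsProbabilityMeasure (P n)] {Ω' : Type*} [MeasurableSpace Ω']
    {P' : Measure Ω'} [IsProbabilityMeasure P'] {κ : Type*} [Finite κ] {ξ : ∀ n, Ω n → Set κ}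
    {ξ' : Ω' → Set κ} (hξ : ∀ n S, NullMeasurableSet {ω | ξ n ω = S} (P n))
    (hξ' : ∀ S, NullMeasurableSet {ω | ξ' ω = S} P')
    (h : ∀ S, Tendsto (fun n => (P n).real {ω | ξ n ω ⊆ S}) atTop (𝓝 (P'.real {ω | ξ' ω ⊆ S})))
    (S : Set κ) :
    Tendsto (fun n => (P n).real {ω | ξ n ω = S}) atTop (𝓝 (P'.real {ω | ξ' ω = S})) := by
  classical
  have := Fintype.ofFinite (Set κ)
  induction S using WellFoundedLT.induction with
  | ind S ih =>
    have hs : ∀ R, R ∈ Finset.univ.filter (fun R : Set κ => R ⊂ S) ↔ R ⊂ S := fun R => by simp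
    simp_rw [measureReal_eq_sub_sum _ (hξ _) _ S hs, measureReal_eq_sub_sum _ hξ' _ S hs]
    exact (h S).sub (tendsto_finsetSum _ fun R hR => ih R ((hs R).1 hR))

end Discretization

/-! ### Portmanteau theorem for bounded continuity sets -/

section Portmanteau

variable {E : Type*} [PseudoMetricSpace E] [MeasurableSpace E] [BorelSpace E]

theorem measureReal_le_integral {μ : Measure E} {B C : Set E} (hB : MeasurableSet B)
    (hC : MeasurableSet C) (hμC : μ C ≠ ∞) {f : E → ℝ} (hf : Continuous f)
    (h0 : ∀ x, 0 ≤ f x) (h1 : ∀ x, f x ≤ 1) (hfB : ∀ x ∈ B, f x = 1) (hfC : ∀ x ∉ C, f x = 0) :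
    μ.real B ≤ ∫ x, f x ∂μ ∧ ∫ x, f x ∂μ ≤ μ.real C := by
  have hBC : B ⊆ C := fun x hx => by
    by_contra h
    exact one_ne_zero ((hfB x hx).symm.trans (hfC x h))
  have iC : Integrable (C.indicator fun _ => (1 : ℝ)) μ :=
    (integrable_indicator_iff hC).2 (integrableOn_const hμC)
  have iB : Integrable (B.indicator fun _ => (1 : ℝ)) μ :=
    (integrable_indicator_iff hB).2 (integrableOn_const (measure_ne_top_of_subset hBC hμC))
  have hfle : ∀ x, f x ≤ C.indicator (fun _ => (1 : ℝ)) x := by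
    intro x
    by_cases hx : x ∈ C
    · rw [indicator_of_mem hx]; exact h1 x
    · rw [indicator_of_notMem hx, hfC x hx]
  have hlef : ∀ x, B.indicator (fun _ => (1 : ℝ)) x ≤ f x := by
    intro x
    by_cases hx : x ∈ B
    · rw [indicator_of_mem hx, hfB x hx]
    · rw [indicator_of_notMem hx]; exact h0 x
  have hfi : Integrable f μ := iC.mono' hf.measurable.aestronglyMeasurable
    (Eventually.of_forall fun x => by rw [Real.norm_of_nonneg (h0 x)]; exact hfle x)
  have e : ∀ {D : Set E}, MeasurableSet D → ∫ x, D.indicator (fun _ => (1 : ℝ)) x ∂μ = μ.real D :=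
    fun hD => integral_indicator_one hD
  rw [← e hB, ← e hC]
  exact ⟨integral_mono iB hfi hlef, integral_mono hfi iC hfle⟩

/-- The indicator of a bounded continuity set of the limit lies, up to small errors, between two
continuous functions with bounded supports. -/
theorem SharpWeakTendsto.tendsto_measureReal {μ : ℕ → Measure E} {ν : Measure E}
    (h : SharpWeakTendsto μ ν) {A : Set E} (hA : MeasurableSet A) (hb : Bornology.IsBounded A)
    (hfr : ν (frontier A) = 0) : Tendsto (fun n => (μ n).real A) atTop (𝓝 (ν.real A)) := by
  have hthick : ∀ δ : ℝ, Bornology.IsBounded (Metric.thickening δ A) := fun δ => hb.thickening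
  have hmt : ∀ (δ : ℝ) (B : Set E), MeasurableSet (Metric.thickening δ B) :=
    fun δ B => Metric.isOpen_thickening.measurableSet
  have hfin : ∀ δ : ℝ, ν (Metric.thickening δ A) ≠ ∞ := fun δ =>
    (h.boundedlyFinite_limit _ (hmt δ A) (hthick δ)).ne
  have hνA : ν A ≠ ∞ := (h.boundedlyFinite_limit _ hA hb).ne
  have up : Tendsto (fun δ => ν.real (Metric.thickening δ A)) (𝓝[>] 0) (𝓝 (ν.real A)) := by
    have := tendsto_measure_thickening (μ := ν) (s := A) ⟨1, one_pos, hfin 1⟩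
    rw [measure_closure_of_null_frontier hfr] at this
    exact (ENNReal.tendsto_toReal hνA).comp this
  -- The inner approximation removes from `A` a thickening of its complement; inside `A` the closure
  -- of `Aᶜ` is part of the frontier, hence null.
  have low : Tendsto (fun δ => ν.real (A \ Metric.thickening δ Aᶜ)) (𝓝[>] 0) (𝓝 (ν.real A)) := by
    have hf : IsFiniteMeasure (ν.restrict A) := ⟨by simpa using hνA.lt_top⟩
    have := tendsto_measure_thickening (μ := ν.restrict A) (s := Aᶜ)
      ⟨1, one_pos, measure_ne_top _ _⟩
    have h0 : (ν.restrict A) (closure Aᶜ) = 0 := by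
      rw [Measure.restrict_apply isClosed_closure.measurableSet]
      refine measure_mono_null ?_ hfr
      rw [frontier_eq_closure_inter_closure, inter_comm]
      exact inter_subset_inter_left _ subset_closure
    rw [h0] at this
    have h2 := (ENNReal.tendsto_toReal ENNReal.zero_ne_top).comp this
    have h3 := h2.const_sub (ν.real A)
    rw [ENNReal.toReal_zero, sub_zero] at h3
    refine h3.congr fun δ => ?_
    have h4 := measureReal_sdiff_add_inter (μ := ν) (s := A) (hmt δ Aᶜ) hνA
    rw [Function.comp_apply, Measure.restrict_apply (hmt δ Aᶜ), inter_comm]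
    change ν.real A - ν.real (A ∩ Metric.thickening δ Aᶜ) = _
    linarith
  rw [Metric.tendsto_nhds]
  intro η hη
  have hup := (up.eventually_lt_const (lt_add_of_pos_right _ hη)).and self_mem_nhdsWithin
  have hlow := (low.eventually_const_lt (sub_lt_self _ hη)).and self_mem_nhdsWithin
  obtain ⟨δ, hδ1, hδ⟩ := hup.exists
  obtain ⟨δ', hδ1', hδ'⟩ := hlow.exists
  have hδ : 0 < δ := hδ
  have hδ' : 0 < δ' := hδ'
  let f : E →ᵇ ℝ := BoundedContinuousFunction.ofNormedAddCommGroup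
    (fun x => (thickenedIndicator hδ A x : ℝ))
    (NNReal.continuous_coe.comp (thickenedIndicator hδ A).continuous) 1 fun x => by
      rw [Real.norm_of_nonneg NNReal.zero_le_coe]; exact_mod_cast thickenedIndicator_le_one hδ A x
  let g : E →ᵇ ℝ := BoundedContinuousFunction.ofNormedAddCommGroup
    (fun x => 1 - (thickenedIndicator hδ' Aᶜ x : ℝ))
    (continuous_const.sub (NNReal.continuous_coe.comp (thickenedIndicator hδ' Aᶜ).continuous)) 1
    fun x => by
      have h1 : (thickenedIndicator hδ' Aᶜ x : ℝ) ≤ 1 := by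
        exact_mod_cast thickenedIndicator_le_one hδ' Aᶜ x
      have h2 : (0 : ℝ) ≤ thickenedIndicator hδ' Aᶜ x := NNReal.zero_le_coe
      rw [Real.norm_of_nonneg (by linarith)]
      linarith
  have hf0 : ∀ x, 0 ≤ f x := fun x => NNReal.zero_le_coe
  have hf1 : ∀ x, f x ≤ 1 := fun x => by exact_mod_cast thickenedIndicator_le_one hδ A x
  have hfA : ∀ x ∈ A, f x = 1 := fun x hx => by
    change ((thickenedIndicator hδ A x : ℝ≥0) : ℝ) = 1
    rw [thickenedIndicator_one hδ A hx]; rfl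
  have hfT : ∀ x ∉ Metric.thickening δ A, f x = 0 := fun x hx => by
    change ((thickenedIndicator hδ A x : ℝ≥0) : ℝ) = 0
    rw [thickenedIndicator_zero hδ A hx]; rfl
  have hg0 : ∀ x, 0 ≤ g x := fun x => by
    have h1 : (thickenedIndicator hδ' Aᶜ x : ℝ) ≤ 1 := by
      exact_mod_cast thickenedIndicator_le_one hδ' Aᶜ x
    change 0 ≤ 1 - (thickenedIndicator hδ' Aᶜ x : ℝ)
    linarith
  have hg1 : ∀ x, g x ≤ 1 := fun x => by
    have h2 : (0 : ℝ) ≤ thickenedIndicator hδ' Aᶜ x := NNReal.zero_le_coe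
    change 1 - (thickenedIndicator hδ' Aᶜ x : ℝ) ≤ 1
    linarith
  have hgA : ∀ x ∉ A, g x = 0 := fun x hx => by
    change 1 - ((thickenedIndicator hδ' Aᶜ x : ℝ≥0) : ℝ) = 0
    rw [thickenedIndicator_one hδ' Aᶜ hx]; simp
  have hgT : ∀ x ∈ A \ Metric.thickening δ' Aᶜ, g x = 1 := fun x hx => by
    change 1 - ((thickenedIndicator hδ' Aᶜ x : ℝ≥0) : ℝ) = 1
    rw [thickenedIndicator_zero hδ' Aᶜ hx.2]; simp
  have hfs : Bornology.IsBounded (Function.support f) :=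
    (hthick δ).subset fun x hx => by
      by_contra hx'
      exact hx (hfT x hx')
  have hgs : Bornology.IsBounded (Function.support g) :=
    hb.subset fun x hx => by
      by_contra hx'
      exact hx (hgA x hx')
  have ef := (measureReal_le_integral hA (hmt δ A) (hfin δ) f.continuous hf0 hf1 hfA hfT).2
  have eg := (measureReal_le_integral (hA.diff (hmt δ' Aᶜ)) hA hνA g.continuous hg0 hg1 hgT hgA).1
  filter_upwards [(h.tendsto f hfs).eventually_lt_const (ef.trans_lt hδ1),
    (h.tendsto g hgs).eventually_const_lt (hδ1'.trans_le eg)] with n h1 h2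
  have hn := h.boundedlyFinite n
  have e1 := (measureReal_le_integral hA (hmt δ A) (hn _ (hmt δ A) (hthick δ)).ne
    f.continuous hf0 hf1 hfA hfT).1
  have e2 := (measureReal_le_integral (hA.diff (hmt δ' Aᶜ)) hA (hn _ hA hb).ne
    g.continuous hg0 hg1 hgT hgA).2
  rw [Real.dist_eq, abs_lt]
  constructor <;> linarith

end Portmanteau

/-! ### Passage between polar coordinates and functions -/

section Polar

variable {T : Type*} [MetricSpace T] [CompactSpace T]

theorem continuous_supNorm : Continuous (supNorm : CPlus T → ℝ≥0) :=
  continuous_id.nndist continuous_const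

namespace ExtCone

theorem dist_eq (p q : ExtCone T) : dist p q =
    |(p.radius⁻¹).toReal - (q.radius⁻¹).toReal| + dist p.shape q.shape := rfl

theorem continuous_shape : Continuous (ExtCone.shape : ExtCone T → CPlus T) :=
  (LipschitzWith.of_dist_le_mul (K := 1) fun p q => by
    rw [dist_eq, NNReal.coe_one, one_mul]
    exact le_add_of_nonneg_left (abs_nonneg _)).continuous

theorem continuous_toReal_inv_radius :
    Continuous (fun p : ExtCone T => (p.radius⁻¹).toReal) :=
  (LipschitzWith.of_dist_le_mul (K := 1) fun p q => by
    rw [dist_eq, NNReal.coe_one, one_mul, Real.dist_eq]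
    exact le_add_of_nonneg_right dist_nonneg).continuous

theorem continuous_radius : Continuous (ExtCone.radius : ExtCone T → ℝ≥0∞) := by
  have : (ExtCone.radius : ExtCone T → ℝ≥0∞) =
      fun p => (ENNReal.ofReal (p.radius⁻¹).toReal)⁻¹ := by
    funext p
    rw [ENNReal.ofReal_toReal (ENNReal.inv_ne_top.2 p.radius_ne_zero), inv_inv]
  rw [this]
  exact (ENNReal.continuous_ofReal.comp continuous_toReal_inv_radius).inv

theorem continuous_polar : Continuous (polar : CPlusZero T → ExtCone T) := by
  have h1 : Continuous fun x : CPlusZero T => (supNorm x.1)⁻¹ :=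
    (continuous_supNorm.comp continuous_subtype_val).inv₀ fun x => supNorm_ne_zero x.2
  have h2 : Continuous fun x : CPlusZero T => (polar x).shape := h1.smul continuous_subtype_val
  have h3 : ∀ x : CPlusZero T, ((polar x).radius⁻¹).toReal = ((supNorm x.1)⁻¹ : ℝ≥0) := by
    intro x
    simp [polar]
  rw [continuous_iff_continuousAt]
  intro x
  rw [ContinuousAt, tendsto_iff_dist_tendsto_zero]
  simp_rw [dist_eq, h3]
  have h4 : Tendsto (fun y : CPlusZero T =>
      |(((supNorm y.1)⁻¹ : ℝ≥0) : ℝ) - ((supNorm x.1)⁻¹ : ℝ≥0)|) (𝓝 x) (𝓝 0) := by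
    have := tendsto_iff_dist_tendsto_zero.1 ((NNReal.continuous_coe.comp h1).tendsto x)
    exact this
  simpa using h4.add (tendsto_iff_dist_tendsto_zero.1 (h2.tendsto x))

/-- The inverse `(r, s) ↦ r s` of the polar decomposition, extended by `0` to infinite radii. -/
noncomputable def unpolar (p : ExtCone T) : CPlus T := p.radius.toNNReal • p.shape

theorem unpolar_polar (x : CPlusZero T) : unpolar (polar x) = x.1 := by
  change (supNorm x.1 : ℝ≥0∞).toNNReal • (supNorm x.1)⁻¹ • x.1 = x.1
  rw [ENNReal.toNNReal_coe, smul_inv_smul₀ (supNorm_ne_zero x.2)]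

theorem supNorm_unpolar (p : ExtCone T) : supNorm (unpolar p) = p.radius.toNNReal := by
  rw [unpolar, supNorm_smul, p.supNorm_shape, mul_one]

theorem continuousAt_unpolar {p : ExtCone T} (hp : p.radius ≠ ∞) : ContinuousAt unpolar p :=
  ((ENNReal.tendsto_toNNReal hp).comp continuous_radius.continuousAt).smul
    continuous_shape.continuousAt

theorem measurable_unpolar : Measurable (unpolar : ExtCone T → CPlus T) :=
  continuous_radius.measurable.ennreal_toNNReal.smul continuous_shape.measurable

/-- Reciprocal radii lie in `[0, 1/ε]` and shapes have norm `1`. This turns separation from the zero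
function into boundedness for `d`. -/
theorem isBounded_of_le_radius {ε : ℝ≥0} (hε : 0 < ε) :
    Bornology.IsBounded {p : ExtCone T | (ε : ℝ≥0∞) ≤ p.radius} := by
  rw [Metric.isBounded_iff]
  refine ⟨(ε : ℝ)⁻¹ + 2, fun p hp q hq => ?_⟩
  have h : ∀ p : ExtCone T, (ε : ℝ≥0∞) ≤ p.radius → (p.radius⁻¹).toReal ≤ (ε : ℝ)⁻¹ := by
    intro p hp
    have : p.radius⁻¹ ≤ ((ε⁻¹ : ℝ≥0) : ℝ≥0∞) := by
      rw [ENNReal.coe_inv hε.ne']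
      exact ENNReal.inv_le_inv.2 hp
    simpa using ENNReal.toReal_mono ENNReal.coe_ne_top this
  have hs : ∀ p : ExtCone T, dist p.shape 0 = 1 := fun p => by
    have := p.supNorm_shape
    rw [supNorm] at this
    rw [← coe_nndist, this, NNReal.coe_one]
  have h1 := h p hp
  have h2 := h q hq
  have h3 : 0 ≤ (p.radius⁻¹).toReal := ENNReal.toReal_nonneg
  have h4 : 0 ≤ (q.radius⁻¹).toReal := ENNReal.toReal_nonneg
  have h5 := dist_triangle_right p.shape q.shape 0
  rw [hs, hs] at h5
  rw [dist_eq]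
  have h6 : |(p.radius⁻¹).toReal - (q.radius⁻¹).toReal| ≤ (ε : ℝ)⁻¹ := by
    rw [abs_le]
    constructor <;> linarith
  linarith

theorem isBounded_unpolar_preimage {ε : ℝ≥0} (hε : 0 < ε) {A : Set (CPlus T)}
    (hA : ∀ x ∈ A, ε ≤ supNorm x) : Bornology.IsBounded (unpolar ⁻¹' A) := by
  refine (isBounded_of_le_radius (T := T) hε).subset fun p hp => ?_
  have := hA _ hp
  rw [supNorm_unpolar] at this
  exact (ENNReal.coe_le_coe.2 this).trans ENNReal.coe_toNNReal_le_self

/-- The map `unpolar` is continuous at every point of finite radius. The infinite radii, where it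
drops to `0`, are negligible for the limit measure. -/
theorem frontier_unpolar_preimage_subset (A : Set (CPlus T)) :
    frontier (unpolar ⁻¹' A) ⊆ unpolar ⁻¹' frontier A ∪ {p | p.radius = ∞} := by
  intro p hp
  by_cases h : p.radius = ∞
  · exact Or.inr h
  · left
    have key : ∀ B : Set (CPlus T), p ∈ closure (unpolar ⁻¹' B) → unpolar p ∈ closure B :=
      fun B hB => closure_mono (image_preimage_subset _ _)
        ((continuousAt_unpolar h).continuousWithinAt.mem_closure_image hB)
    rw [frontier_eq_closure_inter_closure] at hp
    rw [mem_preimage, frontier_eq_closure_inter_closure]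
    exact ⟨key _ hp.1, key _ hp.2⟩

/-- As `A` avoids `0`, the restriction to `C₀⁺` loses nothing, and there `unpolar` undoes `polar`.
-/
theorem inducedMeasure_unpolar_preimage (μ : Measure (CPlus T)) {A : Set (CPlus T)}
    (hA : MeasurableSet A) (h0 : 0 ∉ A) : inducedMeasure μ (unpolar ⁻¹' A) = μ A := by
  have hm : MeasurableSet {x : CPlus T | x ≠ 0} := isOpen_ne.measurableSet
  rw [inducedMeasure, Measure.map_apply continuous_polar.measurable (measurable_unpolar hA)]
  have : (polar ⁻¹' (unpolar ⁻¹' A) : Set (CPlusZero T)) = Subtype.val ⁻¹' A := by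
    ext x
    simp [unpolar_polar]
  rw [this]
  refine ((MeasurableEmbedding.subtype_coe hm).comap_preimage μ A).trans ?_
  rw [Subtype.range_coe]
  congr 1
  exact inter_eq_left.2 fun x hx hx0 => h0 (hx0 ▸ hx)

/-- Vague convergence of `n ℙ[X_n ∈ ·]` on sets of functions which are bounded away from `0`. -/
theorem tendsto_mul_measureReal {μ : ℕ → Measure (CPlus T)} {ν : Measure (ExtCone T)}
    (h : SharpWeakTendsto (fun n => (n : ℝ≥0∞) • inducedMeasure (μ n)) ν)
    (hν : ν {p | p.radius = ∞} = 0) {A : Set (CPlus T)} (hA : MeasurableSet A) {ε : ℝ≥0}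
    (hε : 0 < ε) (hAε : ∀ x ∈ A, ε ≤ supNorm x) (hfr : ν.map unpolar (frontier A) = 0) :
    Tendsto (fun n : ℕ => n * (μ n).real A) atTop (𝓝 ((ν.map unpolar).real A)) := by
  rw [Measure.map_apply measurable_unpolar isClosed_frontier.measurableSet] at hfr
  have h0 : (0 : CPlus T) ∉ A := fun h0 => by
    have := hAε _ h0
    simp [supNorm, hε.ne'] at this
  rw [map_measureReal_apply measurable_unpolar hA]
  refine (h.tendsto_measureReal (measurable_unpolar hA) (isBounded_unpolar_preimage hε hAε)
    (measure_mono_null (frontier_unpolar_preimage_subset A)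
      (measure_union_null hfr hν))).congr fun n => ?_
  rw [measureReal_def, Measure.smul_apply, inducedMeasure_unpolar_preimage _ hA h0, smul_eq_mul,
    ENNReal.toReal_mul, ENNReal.toReal_natCast, measureReal_def]

end ExtCone

end Polar

/-! ### Void probabilities of samples and of Poisson processes -/

section VoidProbabilities

/-- Write `(1 - p) ^ m` as `((1 - p) ^ n) ^ (m / n)` with a real outer exponent; the inner power
tends to `exp (-c)`. -/
theorem tendsto_one_sub_pow_of_tendsto_mul {p : ℕ → ℝ} {m : ℕ → ℕ} {c h : ℝ}
    (hp : ∀ n, p n ≤ 1) (hc : Tendsto (fun n : ℕ => n * p n) atTop (𝓝 c))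
    (hm : Tendsto (fun n : ℕ => (m n : ℝ) / n) atTop (𝓝 h)) :
    Tendsto (fun n => (1 - p n) ^ m n) atTop (𝓝 (Real.exp (-(c * h)))) := by
  have h1 : Tendsto (fun n : ℕ => (1 + -p n) ^ n) atTop (𝓝 (Real.exp (-c))) := by
    apply Real.tendsto_one_add_pow_exp_of_tendsto
    simpa using hc.neg
  have h2 := h1.rpow hm (Or.inl (Real.exp_pos _).ne')
  rw [← Real.exp_mul, neg_mul] at h2
  refine h2.congr' ?_
  filter_upwards [eventually_gt_atTop 0] with n hn
  have hn' : (n : ℝ) ≠ 0 := by exact_mod_cast hn.ne'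
  rw [← sub_eq_add_neg, ← Real.rpow_natCast (1 - p n) n, ← Real.rpow_mul (by linarith [hp n]),
    mul_div_cancel₀ _ hn', Real.rpow_natCast]

/-- The index blocks are disjoint, so the event imposes at most one condition on each independent
variable and its probability factorizes. -/
theorem measureReal_void_eq_prod {Ω E : Type*} [MeasurableSpace Ω] [MeasurableSpace E]
    {P : Measure Ω} [IsProbabilityMeasure P] {X : ℕ → Ω → E} (hX : ∀ i, AEMeasurable (X i) P)
    (hindep : iIndepFun X P) {μ : Measure E} (hlaw : ∀ i, P.map (X i) = μ) {L : ℕ} {a : ℕ → ℕ}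
    (ha : Monotone a) {B : Fin L → Set E} (hB : ∀ l, MeasurableSet (B l)) :
    P.real {ω | ∀ l : Fin L, ∀ i ∈ Ico (a l) (a (l + 1)), X i ω ∉ B l} =
      ∏ l : Fin L, (1 - μ.real (B l)) ^ (a (l + 1) - a l) := by
  classical
  have hμ : IsProbabilityMeasure μ := hlaw 0 ▸ Measure.isProbabilityMeasure_map (hX 0)
  have hdisj : ∀ l l' : Fin L, ∀ i, i ∈ Finset.Ico (a l) (a (l + 1)) →
      i ∈ Finset.Ico (a l') (a (l' + 1)) → l = l' := by
    intro l l' i hi hi'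
    rw [Finset.mem_Ico] at hi hi'
    by_contra hne
    rcases lt_or_gt_of_ne hne with h | h
    · have := ha (show (l : ℕ) + 1 ≤ l' from h)
      omega
    · have := ha (show (l' : ℕ) + 1 ≤ l from h)
      omega
  let s : Finset ℕ := Finset.univ.biUnion fun l : Fin L => Finset.Ico (a l) (a (l + 1))
  let A : ℕ → Set E := fun i => {w | ∀ l : Fin L, i ∈ Finset.Ico (a l) (a (l + 1)) → w ∉ B l}
  have hAeq : ∀ l : Fin L, ∀ i ∈ Finset.Ico (a l) (a (l + 1)), A i = (B l)ᶜ := by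
    intro l i hi
    ext w
    refine ⟨fun h => h l hi, fun h l' hi' => ?_⟩
    rw [← hdisj l l' i hi hi']
    exact h
  have hA : ∀ i ∈ s, MeasurableSet (A i) := by
    intro i hi
    obtain ⟨l, -, hl⟩ := Finset.mem_biUnion.1 hi
    rw [hAeq l i hl]
    exact (hB l).compl
  have hev : {ω | ∀ l : Fin L, ∀ i ∈ Ico (a l) (a (l + 1)), X i ω ∉ B l} =
      ⋂ i ∈ s, X i ⁻¹' A i := by
    ext ω
    simp only [mem_ofPred_eq, mem_iInter, mem_preimage, A, s, Finset.mem_biUnion, Finset.mem_univ,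
      true_and, Finset.mem_Ico, mem_Ico]
    exact ⟨fun h i _ l hi => h l i hi, fun h l i hi => h i ⟨l, hi⟩ l hi⟩
  rw [hev, measureReal_def, hindep.measure_inter_preimage_eq_mul s hA, ENNReal.toReal_prod,
    Finset.prod_biUnion]
  · refine Finset.prod_congr rfl fun l _ => ?_
    rw [← Nat.card_Ico, ← Finset.prod_const]
    refine Finset.prod_congr rfl fun i hi => ?_
    rw [hAeq l i hi, ← Measure.map_apply_of_aemeasurable (hX i) (hB l).compl, hlaw,
      ← measureReal_def, probReal_compl_eq_one_sub (hB l)]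
  · intro l _ l' _ hne
    rw [Function.onFun, Finset.disjoint_left]
    exact fun i hi hi' => hne (hdisj l l' i hi hi')

/-- Slabs open on the left and closed on the right, together with the shift to `i + 1`, translate
exactly into half-open blocks of indices between floors. -/
theorem div_mem_timeSlab_iff {n : ℕ} (hn : n ≠ 0) {h : ℝ≥0} {l i : ℕ} :
    ((i : ℝ≥0) + 1) / n ∈ timeSlab h l ↔
      i ∈ Ico ⌊(l : ℝ≥0) * h * n⌋₊ ⌊((l + 1 : ℕ) : ℝ≥0) * h * n⌋₊ := by
  have hn' : (0 : ℝ≥0) < n := by exact_mod_cast pos_iff_ne_zero.2 hn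
  have e : ((i : ℝ≥0) + 1) = ((i + 1 : ℕ) : ℝ≥0) := by push_cast; rfl
  rw [timeSlab, mem_Ioc, mem_Ico, lt_div_iff₀ hn', div_le_iff₀ hn', e,
    ← Nat.floor_lt zero_le, ← Nat.le_floor_iff zero_le, Nat.lt_succ_iff, Nat.succ_le_iff]
  push_cast
  rfl

theorem nat_floor_coe_nnreal (a : ℝ≥0) : ⌊(a : ℝ)⌋₊ = ⌊a⌋₊ := by
  refine (Nat.floor_eq_iff a.2).2 ⟨?_, ?_⟩
  · exact_mod_cast Nat.floor_le (zero_le (a := a))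
  · exact_mod_cast Nat.lt_floor_add_one a

theorem tendsto_floor_sub_floor_div (h : ℝ≥0) (l : ℕ) :
    Tendsto (fun n : ℕ => ((⌊((l + 1 : ℕ) : ℝ≥0) * h * n⌋₊ - ⌊(l : ℝ≥0) * h * n⌋₊ : ℕ) : ℝ) / n)
      atTop (𝓝 h) := by
  have key : ∀ a : ℝ≥0, Tendsto (fun n : ℕ => (⌊a * (n : ℝ≥0)⌋₊ : ℝ) / n) atTop (𝓝 a) := by
    intro a
    refine ((tendsto_nat_floor_mul_div_atTop a.coe_nonneg).comp
      tendsto_natCast_atTop_atTop).congr fun n => ?_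
    have e : (a : ℝ) * n = ((a * n : ℝ≥0) : ℝ) := by push_cast; rfl
    rw [Function.comp_apply, e, nat_floor_coe_nnreal]
  have h1 := (key (((l + 1 : ℕ) : ℝ≥0) * h)).sub (key ((l : ℝ≥0) * h))
  have h2 : ((((l + 1 : ℕ) : ℝ≥0) * h : ℝ≥0) : ℝ) - ((l : ℝ≥0) * h : ℝ≥0) = h := by
    push_cast; ring
  rw [h2] at h1
  refine h1.congr fun n => ?_
  rw [Nat.cast_sub, sub_div]
  gcongr
  exact l.le_succ

variable {E : Type*} [PseudoMetricSpace E] [MeasurableSpace E] {Ω : Type*} [MeasurableSpace Ω]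
  {N : Ω → Measure E} {μ : Measure E} {P : Measure Ω}

namespace IsPoissonPointProcess

theorem measurable_count (hN : IsPoissonPointProcess N μ P) {B : Set E} (hB : MeasurableSet B) :
    Measurable fun ω => N ω B :=
  (Measure.measurable_coe hB).comp hN.measurable

theorem measure_count_mem (hN : IsPoissonPointProcess N μ P) {B : Set E} (hB : MeasurableSet B)
    (hb : Bornology.IsBounded B) {s : Set ℝ≥0∞} (hs : MeasurableSet s) :
    P {ω | N ω B ∈ s} = poissonMeasure (μ B).toNNReal ((fun k : ℕ => (k : ℝ≥0∞)) ⁻¹' s) := by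
  have h : P.map (fun ω => N ω B) s =
      (poissonMeasure (μ B).toNNReal).map (fun k : ℕ => (k : ℝ≥0∞)) s := by
    rw [hN.map_apply B hB hb]
  rw [Measure.map_apply (hN.measurable_count hB) hs,
    Measure.map_apply measurable_from_top hs] at h
  exact h

theorem measureReal_count_eq_zero (hN : IsPoissonPointProcess N μ P) {B : Set E}
    (hB : MeasurableSet B) (hb : Bornology.IsBounded B) :
    P.real {ω | N ω B = 0} = Real.exp (-μ.real B) := by
  have h := hN.measure_count_mem hB hb (measurableSet_singleton 0)
  have e : (fun k : ℕ => (k : ℝ≥0∞)) ⁻¹' {0} = {0} := by ext k; simp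
  rw [e, poissonMeasure_singleton] at h
  have h' : P {ω | N ω B = 0} = _ := h
  rw [measureReal_def, h', ENNReal.toReal_ofReal (by positivity)]
  simp [measureReal_def, ENNReal.toReal]

theorem measureReal_count_ne_zero_le [IsProbabilityMeasure P] (hN : IsPoissonPointProcess N μ P)
    {B : Set E} (hB : MeasurableSet B) (hb : Bornology.IsBounded B) :
    P.real {ω | N ω B ≠ 0} ≤ μ.real B := by
  have h : P.real {ω | N ω B ≠ 0} = 1 - P.real {ω | N ω B = 0} :=
    probReal_compl_eq_one_sub (hN.measurable_count hB (measurableSet_singleton 0))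
  rw [h, hN.measureReal_count_eq_zero hB hb]
  linarith [Real.add_one_le_exp (-μ.real B)]

/-- With mean `λ` the probability is `1 - (1 + λ) exp (-λ)`, and `exp (-λ) ≥ 1 - λ`. The quadratic
order makes the sum over all slabs small. -/
theorem measureReal_two_le_count_le [IsProbabilityMeasure P] (hN : IsPoissonPointProcess N μ P)
    {B : Set E} (hB : MeasurableSet B) (hb : Bornology.IsBounded B) :
    P.real {ω | 2 ≤ N ω B} ≤ μ.real B ^ 2 := by
  have h := hN.measure_count_mem hB hb (measurableSet_Ici (a := 2))
  have e : (fun k : ℕ => (k : ℝ≥0∞)) ⁻¹' Ici 2 = {0, 1}ᶜ := by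
    ext k
    simp only [mem_preimage, mem_Ici, mem_compl_iff, mem_insert_iff, mem_singleton_iff]
    have : (2 : ℝ≥0∞) ≤ k ↔ 2 ≤ k := by exact_mod_cast Iff.rfl
    rw [this]
    omega
  rw [e] at h
  have h' : P {ω | 2 ≤ N ω B} = _ := h
  have hpair : ({0, 1} : Set ℕ) = {0} ∪ {1} := rfl
  rw [measureReal_def, h', ← measureReal_def, probReal_compl_eq_one_sub (.of_discrete), hpair,
    measureReal_union (by simp) (.of_discrete), poissonMeasure_real_singleton,
    poissonMeasure_real_singleton]
  have hl : (((μ B).toNNReal : ℝ≥0) : ℝ) = μ.real B := rfl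
  rw [hl]
  have h0 : 0 ≤ μ.real B := measureReal_nonneg
  have h1 := Real.add_one_le_exp (-μ.real B)
  simp only [pow_zero, Nat.factorial, pow_one]
  push_cast
  nlinarith

end IsPoissonPointProcess

end VoidProbabilities

/-! ### Lebesgue measure on the half-line -/

section HalfLine

theorem map_coe_lebesgueHalfLine :
    lebesgueHalfLine.map (fun u : ℝ≥0 => (u : ℝ)) = (volume : Measure ℝ).restrict (Ici 0) := by
  have he : MeasurableEmbedding (fun u : ℝ≥0 => (u : ℝ)) :=
    NNReal.isClosedEmbedding_coe.measurableEmbedding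
  rw [lebesgueHalfLine, he.map_comap]
  congr 1
  ext x
  exact ⟨fun ⟨u, hu⟩ => hu ▸ u.2, fun h => ⟨⟨x, h⟩, rfl⟩⟩

instance : SigmaFinite lebesgueHalfLine := by
  have : SigmaFinite (lebesgueHalfLine.map (fun u : ℝ≥0 => (u : ℝ))) := by
    rw [map_coe_lebesgueHalfLine]; infer_instance
  exact SigmaFinite.of_map _ measurable_coe_nnreal_real.aemeasurable this

theorem lebesgueHalfLine_apply (s : Set ℝ≥0) :
    lebesgueHalfLine s = volume ((fun u : ℝ≥0 => (u : ℝ)) '' s) :=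
  (NNReal.isClosedEmbedding_coe.measurableEmbedding).comap_apply _ _

theorem lebesgueHalfLine_Ioc (a b : ℝ≥0) : lebesgueHalfLine (Ioc a b) = (b - a : ℝ≥0) := by
  rw [lebesgueHalfLine_apply]
  have := NNReal.image_coe_Ioc a b
  rw [this, Real.volume_Ioc, NNReal.sub_def]
  rfl

theorem lebesgueHalfLine_singleton (a : ℝ≥0) : lebesgueHalfLine {a} = 0 := by
  rw [lebesgueHalfLine_apply]
  simp

end HalfLine

/-! ### Partition into small continuity sets -/

section Partition

variable {T : Type*} [MetricSpace T] [CompactSpace T]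

theorem isClosed_le_supNorm (ε : ℝ≥0) : IsClosed {w : CPlus T | ε ≤ supNorm w} :=
  isClosed_le continuous_const continuous_supNorm

/-- There are arbitrarily low levels whose exceedance set is a continuity set. -/
theorem exists_level_null_frontier {ν : Measure (CPlus T)}
    (hfin : ∀ ε : ℝ≥0, 0 < ε → ν {w | ε ≤ supNorm w} ≠ ∞) {δ : ℝ≥0} (hδ : 0 < δ) :
    ∃ ε, 0 < ε ∧ ε ≤ δ ∧ ν (frontier {w | ε ≤ supNorm w}) = 0 := by
  have hδ2 : 0 < δ / 2 := half_pos hδ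
  have hm : Measurable fun w : CPlus T => (supNorm w : ℝ) :=
    (NNReal.continuous_coe.comp continuous_supNorm).measurable
  have hfin' : IsFiniteMeasure (ν.restrict {w | δ / 2 ≤ supNorm w}) :=
    ⟨by simpa using (hfin _ hδ2).lt_top⟩
  have hc := Measure.countable_meas_level_set_pos (μ := ν.restrict {w | δ / 2 ≤ supNorm w}) hm
  have hlt : ((δ / 2 : ℝ≥0) : ℝ) < δ := NNReal.half_lt_self hδ.ne'
  -- Above `δ / 2` the measure is finite, so only countably many spheres have positive mass; a
  -- radius between `δ / 2` and `δ` avoids them.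
  obtain ⟨r, hr, h1, h2⟩ := (hc.dense_compl ℝ).exists_between hlt
  have hr0 : 0 ≤ r := ((δ / 2).coe_nonneg).trans h1.le
  lift r to ℝ≥0 using hr0
  have h1 : δ / 2 < r := h1
  refine ⟨r, hδ2.trans h1, le_of_lt h2, ?_⟩
  have hr' : (ν.restrict {w | δ / 2 ≤ supNorm w})
      ((fun w => (supNorm w : ℝ)) ⁻¹' {(r : ℝ)}) = 0 := nonpos_iff_eq_zero.1 (not_lt.1 hr)
  rw [Measure.restrict_apply (hm (measurableSet_singleton (r : ℝ)))] at hr'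
  refine measure_mono_null (fun w hw => ?_) hr'
  have : r = supNorm w := frontier_le_subset_eq continuous_const continuous_supNorm hw
  refine ⟨?_, ?_⟩
  · change (supNorm w : ℝ) = r
    rw [← this]
  · exact h1.le.trans this.le

/-- A closed continuity set of finite measure is cut into finitely many small continuity sets and a
remainder of small measure. -/
theorem exists_partition {E : Type*} [PseudoMetricSpace E] [SecondCountableTopology E] [Nonempty E]
    [MeasurableSpace E] [BorelSpace E] {ν : Measure E} {C : Set E} (hC : IsClosed C)
    (hfin : ν C ≠ ∞) (hfr : ν (frontier C) = 0) {δ : ℝ} (hδ : 0 < δ) {η : ℝ≥0∞} (hη : 0 < η) :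
    ∃ (k : ℕ) (A : Option (Fin k) → Set E) (y : Option (Fin k) → E),
      (∀ j, MeasurableSet (A j)) ∧ (∀ j, ν (frontier (A j)) = 0) ∧
      (∀ w, (∃ j, w ∈ A j) ↔ w ∈ C) ∧ (∀ j j' w, w ∈ A j → w ∈ A j' → j = j') ∧
      (∀ j, j ≠ none → ∀ w ∈ A j, dist w (y j) ≤ δ) ∧ ν (A none) ≤ η := by
  have hfin' : IsFiniteMeasure (ν.restrict C) := ⟨by simpa using hfin.lt_top⟩
  let q := TopologicalSpace.denseSeq E
  -- Radii above `δ / 2` let the balls around a dense sequence cover the space; radii below `δ` keep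
  -- every point of a ball within `δ` of its centre.
  choose r hr hrfr using fun m : ℕ =>
    exists_null_frontier_thickening (ν.restrict C) {q m} (half_lt_self hδ)
  let b : ℕ → Set E := fun m => Metric.thickening (r m) {q m}
  have hbo : ∀ m, IsOpen (b m) := fun m => Metric.isOpen_thickening
  have hmem : ∀ m w, w ∈ b m ↔ dist w (q m) < r m := fun m w => by
    simp [b, Metric.thickening_singleton]
  let D : ℕ → Set E := fun m => ⋂ i < m, (b i)ᶜ
  have hDmem : ∀ m w, w ∈ D m ↔ ∀ i < m, w ∉ b i := fun m w => by simp [D]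
  have hDsucc : ∀ m, D (m + 1) = D m ∩ (b m)ᶜ := fun m => by
    ext w
    simp only [mem_inter_iff, hDmem, Nat.lt_succ_iff_lt_or_eq, mem_compl_iff]
    exact ⟨fun h => ⟨fun i hi => h i (Or.inl hi), h m (Or.inr rfl)⟩,
      fun h i hi => hi.elim (h.1 i) fun e => e ▸ h.2⟩
  have hDm : ∀ m, MeasurableSet (D m) := fun m =>
    MeasurableSet.biInter (to_countable _) fun i _ => (hbo i).measurableSet.compl
  have hDfr : ∀ m, (ν.restrict C) (frontier (D m)) = 0 := by
    intro m
    induction m with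
    | zero => simp [D]
    | succ m ih =>
      rw [hDsucc]
      exact null_frontier_inter ih (by rw [frontier_compl]; exact hrfr m)
  have hCfr : (ν.restrict C) (frontier C) = 0 :=
    Measure.absolutelyContinuous_of_le Measure.restrict_le_self hfr
  -- Closedness of `C` keeps the frontier of `C ∩ B` inside `C`, where `ν` and its restriction
  -- agree.
  have hsub : ∀ B : Set E, (ν.restrict C) (frontier (C ∩ B)) = 0 → ν (frontier (C ∩ B)) = 0 := by
    intro B h
    rw [Measure.restrict_apply isClosed_frontier.measurableSet] at h
    refine measure_mono_null (subset_inter subset_rfl ?_) h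
    exact frontier_subset_closure.trans (closure_minimal inter_subset_left hC)
  have hlim : Tendsto (fun m => ν (C ∩ D m)) atTop (𝓝 0) := by
    have hanti : Antitone fun m => C ∩ D m := fun m m' hmm' =>
      inter_subset_inter_right _ fun w hw => (hDmem m w).2 fun i hi =>
        (hDmem m' w).1 hw i (hi.trans_le hmm')
    have h := tendsto_measure_iInter_atTop (μ := ν)
      (fun m => (hC.measurableSet.inter (hDm m)).nullMeasurableSet) hanti
      ⟨0, measure_ne_top_of_subset inter_subset_left hfin⟩
    have hempty : ⋂ m, C ∩ D m = ∅ := by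
      rw [eq_empty_iff_forall_notMem]
      intro w hw
      obtain ⟨m, hm⟩ := (TopologicalSpace.denseRange_denseSeq E).exists_dist_lt w (half_pos hδ)
      refine (hDmem (m + 1) w).1 (mem_iInter.1 hw (m + 1)).2 m m.lt_succ_self ((hmem m w).2 ?_)
      exact hm.trans (hr m).1
    rwa [hempty, measure_empty] at h
  -- What the first `k` balls leave uncovered becomes the cell `none`; the other cells are the balls
  -- made disjoint.
  obtain ⟨k, hk⟩ := (hlim.eventually_le_const hη).exists
  refine ⟨k, fun j => j.elim (C ∩ D k) fun j => C ∩ (b j ∩ D j),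
    fun j => j.elim (q 0) fun j => q j, ?_, ?_, ?_, ?_, ?_, hk⟩
  · rintro (_ | j)
    · exact hC.measurableSet.inter (hDm k)
    · exact hC.measurableSet.inter ((hbo j).measurableSet.inter (hDm j))
  · rintro (_ | j)
    · exact hsub _ (null_frontier_inter hCfr (hDfr k))
    · exact hsub _ (null_frontier_inter hCfr (null_frontier_inter (hrfr j) (hDfr j)))
  · intro w
    constructor
    · rintro ⟨_ | j, h⟩
      · exact h.1
      · exact h.1
    · intro hw
      classical
      by_cases h : ∃ m, m < k ∧ w ∈ b m
      · have hspec := Nat.find_spec h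
        refine ⟨some ⟨Nat.find h, hspec.1⟩, hw, hspec.2, (hDmem _ w).2 fun i hi hib => ?_⟩
        exact Nat.find_min h hi ⟨hi.trans hspec.1, hib⟩
      · exact ⟨none, hw, (hDmem k w).2 fun i hi hib => h ⟨i, hi, hib⟩⟩
  · rintro (_ | j) (_ | j') w h h'
    · rfl
    · exact absurd h'.2.1 ((hDmem k w).1 h.2 j' j'.2)
    · exact absurd h.2.1 ((hDmem k w).1 h'.2 j j.2)
    · congr 1
      by_contra hne
      rcases lt_or_gt_of_ne hne with hlt | hlt
      · exact (hDmem j' w).1 h'.2.2 j hlt h.2.1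
      · exact (hDmem j w).1 h.2.2 j' hlt h'.2.1
  · rintro (_ | j) hj w hw
    · exact absurd rfl hj
    · exact (((hmem j w).1 hw.2.1).trans (hr j).2).le

end Partition

/-! ### Partial maxima as running suprema -/

section MaximaPath

theorem isLUB_image_range {T : Type*} [TopologicalSpace T] (f : ℕ → CPlus T) (m : ℕ) (t : T) :
    IsLUB ((fun i => f i t) '' {i | i < m}) ((Finset.range m).sup fun i => f i t) := by
  have := Finset.isLUB_sup (s := Finset.range m) (f := fun i => f i t)
  simpa [Iio] using this

/-- The points not yet arrived contribute the value `0`, which is below every element of `ℝ≥0`; the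
two sets have the same upper bounds. -/
theorem isLUB_range_indicator_iff {T : Type*} [TopologicalSpace T] {I : Type*}
    {Y : I → CPlus T} {U : I → ℝ≥0} {u : ℝ≥0}
    {t : T} {r : ℝ≥0} : IsLUB (range fun i => (Ici (U i)).indicator (fun _ => Y i t) u) r ↔
      IsLUB ((fun i => Y i t) '' {i | U i ≤ u}) r := by
  apply isLUB_congr
  ext b
  simp only [mem_upperBounds, forall_mem_range, forall_mem_image, mem_ofPred_eq]
  refine forall_congr' fun i => ?_
  by_cases h : U i ≤ u
  · simp [h]
  · simp [h]

variable {T : Type*} [MetricSpace T] [CompactSpace T]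

theorem add_one_div_le_iff {n : ℕ} (hn : n ≠ 0) {i : ℕ} {u : ℝ≥0} :
    ((i : ℝ≥0) + 1) / n ≤ u ↔ i < ⌊(n : ℝ≥0) * u⌋₊ := by
  have hn' : (0 : ℝ≥0) < n := by exact_mod_cast pos_iff_ne_zero.2 hn
  rw [div_le_iff₀ hn', ← Nat.succ_le_iff, Nat.le_floor_iff zero_le, mul_comm u]
  push_cast
  rfl

/-- The sample with index `i` enters at time `(i + 1) / n`, so exactly `⌊n u⌋` samples have entered
by `u`. Partial maxima and Poisson suprema thereby fall under one notion. -/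
theorem isSupPath_iff_of_maxima {T : Type*} [MetricSpace T] {n : ℕ} (hn : n ≠ 0) {f : ℕ → CPlus T}
    {x : SkorokhodSpace (CPlus T)} : IsSupPath f (fun i => ((i : ℝ≥0) + 1) / n) x ↔
      ∀ u t, x u t = (Finset.range ⌊(n : ℝ≥0) * u⌋₊).sup fun i => f i t := by
  refine forall₂_congr fun u t => ?_
  simp_rw [add_one_div_le_iff hn]
  exact ⟨fun h => h.unique (isLUB_image_range f _ t), fun h => h ▸ isLUB_image_range f _ t⟩

theorem locallyFinitePoints_maxima {n : ℕ} (hn : n ≠ 0) (f : ℕ → CPlus T) :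
    LocallyFinitePoints f (fun i => ((i : ℝ≥0) + 1) / n) := by
  intro ε _ K
  refine (finite_lt_nat ⌊(n : ℝ≥0) * K⌋₊).subset fun i hi => ?_
  exact (add_one_div_le_iff hn).1 hi.2

theorem exists_maxima_path (n : ℕ) (f : ℕ → CPlus T) : ∃ x : SkorokhodSpace (CPlus T),
    ∀ u t, x u t = (Finset.range ⌊(n : ℝ≥0) * u⌋₊).sup fun i => f i t := by
  -- For `n = 0` division by zero would put all points at time `0`, whereas the maximum is over an
  -- empty range; the path is constantly `0`.
  rcases eq_or_ne n 0 with rfl | hn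
  · exact ⟨⟨fun _ => 0, fun _ => continuousWithinAt_const, fun _ => ⟨0, tendsto_const_nhds⟩⟩,
      fun u t => by simp⟩
  · obtain ⟨x, hx⟩ := (locallyFinitePoints_maxima hn f).exists_isSupPath
    exact ⟨x, (isSupPath_iff_of_maxima hn).1 hx⟩

/-- The path of partial maxima depends continuously on the sequence. -/
theorem continuous_maxima_path {n : ℕ} {Φ : (ℕ → CPlus T) → SkorokhodSpace (CPlus T)}
    (hΦ : ∀ f u t, Φ f u t = (Finset.range ⌊(n : ℝ≥0) * u⌋₊).sup fun i => f i t) :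
    Continuous Φ := by
  rw [continuous_def]
  intro s hs
  rw [isOpen_iff_mem_nhds]
  intro f hf
  obtain ⟨K, ε, hε, h⟩ := hs (Φ f) hf
  have hnhd : ∀ᶠ g in 𝓝 f, ∀ i ∈ Finset.range ⌊(n : ℝ≥0) * K⌋₊, dist (g i) (f i) < ε := by
    rw [Filter.eventually_all_finset]
    intro i _
    exact (continuous_apply i).continuousAt.eventually (Metric.ball_mem_nhds (f i) hε)
  filter_upwards [hnhd] with g hg
  -- The entry times do not depend on the sequence, so no time change is needed; a maximum is
  -- 1-Lipschitz in its entries, finitely many of which matter up to `K`.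
  refine h ⟨OrderIso.refl _, fun u hu => ⟨by simpa using hε.le, ?_⟩⟩
  rw [OrderIso.refl_apply, ContinuousMap.dist_le hε.le]
  intro t
  rw [hΦ, hΦ]
  have hval : ∀ i < ⌊(n : ℝ≥0) * u⌋₊, dist (g i t) (f i t) ≤ ε := fun i hi =>
    (ContinuousMap.dist_apply_le_dist t).trans (hg i (Finset.mem_range.2
      (hi.trans_le (Nat.floor_le_floor (mul_le_mul_right hu _))))).le
  have hlub := fun f : ℕ → CPlus T => isLUB_image_range f ⌊(n : ℝ≥0) * u⌋₊ t
  lift ε to ℝ≥0 using hε.le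
  have hval' : ∀ i < ⌊(n : ℝ≥0) * u⌋₊, g i t ≤ f i t + ε ∧ f i t ≤ g i t + ε := fun i hi => by
    have := hval i hi
    rw [NNReal.dist_eq, abs_le] at this
    constructor
    · rw [← NNReal.coe_le_coe]; push_cast; linarith
    · rw [← NNReal.coe_le_coe]; push_cast; linarith
  refine dist_le_of_isLUB (hlub g) (hlub f) ?_ ?_
  · rintro _ ⟨i, hi, rfl⟩
    exact (hval' i hi).1.trans (add_le_add_left ((hlub f).1 ⟨i, hi, rfl⟩) _)
  · rintro _ ⟨i, hi, rfl⟩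
    exact (hval' i hi).2.trans (add_le_add_left ((hlub g).1 ⟨i, hi, rfl⟩) _)

end MaximaPath

/-! ### Occupied cells and the laws of their configurations -/

section OccupiedCells

variable {E J I : Type*}

/-- The set of the cells `A j × timeSlab h l` which contain at least one of the points
`(Y i, U i)`. -/
def occupiedCells (A : J → Set (E)) (h : ℝ≥0) (L : ℕ) (Y : I → E) (U : I → ℝ≥0) :
    Set (J × Fin L) :=
  {s | ∃ i, Y i ∈ A s.1 ∧ U i ∈ timeSlab h s.2}

/-- The union of the sets `A j` over the cells outside `S` in the `l`-th time slab. -/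
def cellUnion (A : J → Set (E)) {L : ℕ} (S : Set (J × Fin L)) (l : Fin L) :
    Set (E) :=
  ⋃ j ∈ {j | (j, l) ∉ S}, A j

theorem mem_cellUnion {A : J → Set (E)} {L : ℕ} {S : Set (J × Fin L)} {l : Fin L}
    {w : E} : w ∈ cellUnion A S l ↔ ∃ j, (j, l) ∉ S ∧ w ∈ A j := by
  simp [cellUnion]

/-- This rewrites inclusion as a void event: slab by slab, no point falls in the cells missing from
`S`. -/
theorem occupiedCells_subset_iff {A : J → Set (E)} {h : ℝ≥0} {L : ℕ} {Y : I → E}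
    {U : I → ℝ≥0} {S : Set (J × Fin L)} : occupiedCells A h L Y U ⊆ S ↔
      ∀ l : Fin L, ∀ i, U i ∈ timeSlab h l → Y i ∉ cellUnion A S l := by
  constructor
  · intro hS l i hi hY
    obtain ⟨j, hj, hA⟩ := mem_cellUnion.1 hY
    exact hj (hS ⟨i, hA, hi⟩)
  · rintro hS ⟨j, l⟩ ⟨i, hA, hi⟩
    by_contra hj
    exact hS l i hi (mem_cellUnion.2 ⟨j, hj, hA⟩)

theorem null_frontier_biUnion {κ : Type*} [TopologicalSpace E] [MeasurableSpace E]
    {ν : Measure E} {A : κ → Set E} (hA : ∀ j, ν (frontier (A j)) = 0) {s : Set κ}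
    (hs : s.Finite) : ν (frontier (⋃ j ∈ s, A j)) = 0 := by
  induction s, hs using Set.Finite.induction_on with
  | empty => simp
  | insert _ _ ih =>
    rw [biUnion_insert]
    refine measure_mono_null (frontier_union_subset _ _) (measure_union_null ?_ ?_)
    · exact measure_mono_null inter_subset_left (hA _)
    · exact measure_mono_null inter_subset_right ih

theorem nullMeasurableSet_eq_of_mem {Ω κ : Type*} [MeasurableSpace Ω] [Countable κ]
    {μ : Measure Ω} {ξ : Ω → Set κ} (h : ∀ s, NullMeasurableSet {ω | s ∈ ξ ω} μ) (S : Set κ) :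
    NullMeasurableSet {ω | ξ ω = S} μ := by
  have : {ω | ξ ω = S} = ⋂ s, {ω | s ∈ ξ ω ↔ s ∈ S} := by
    ext ω
    simp [Set.ext_iff]
  rw [this]
  refine NullMeasurableSet.iInter fun s => ?_
  by_cases hs : s ∈ S
  · simpa [hs] using h s
  · simp only [hs, iff_false]
    exact (h s).compl

/-- Convergence of the void probabilities of the normalized samples. -/
theorem tendsto_occupiedCells_maxima_subset {T : Type*} [MetricSpace T] [CompactSpace T]
    {Ω : ℕ → Type*} [∀ n, MeasurableSpace (Ω n)] {P : ∀ n, Measure (Ω n)}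
    [∀ n, IsProbabilityMeasure (P n)] {X : ∀ n, ℕ → Ω n → CPlus T}
    (hX : ∀ n i, AEMeasurable (X n i) (P n)) (hindep : ∀ n, iIndepFun (X n) (P n))
    {μ : ℕ → Measure (CPlus T)} (hlaw : ∀ n i, (P n).map (X n i) = μ n) {ν : Measure (CPlus T)}
    {A : J → Set (CPlus T)} {h : ℝ≥0} {L : ℕ} {S : Set (J × Fin L)}
    (hm : ∀ l, MeasurableSet (cellUnion A S l))
    (hlim : ∀ l, Tendsto (fun n : ℕ => n * (μ n).real (cellUnion A S l)) atTop
      (𝓝 (ν.real (cellUnion A S l)))) :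
    Tendsto (fun n => (P n).real
      {ω | occupiedCells A h L (fun i => X n i ω) (fun i => ((i : ℝ≥0) + 1) / n) ⊆ S}) atTop
      (𝓝 (Real.exp (-∑ l, ν.real (cellUnion A S l) * h))) := by
  have hμ : ∀ n, IsProbabilityMeasure (μ n) := fun n =>
    hlaw n 0 ▸ Measure.isProbabilityMeasure_map (hX n 0)
  rw [← Finset.sum_neg_distrib, Real.exp_sum]
  have hprod : Tendsto (fun n => ∏ l : Fin L, (1 - (μ n).real (cellUnion A S l)) ^
      (⌊((l + 1 : ℕ) : ℝ≥0) * h * n⌋₊ - ⌊((l : ℕ) : ℝ≥0) * h * n⌋₊)) atTop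
      (𝓝 (∏ l : Fin L, Real.exp (-(ν.real (cellUnion A S l) * h)))) :=
    tendsto_finsetProd _ fun l _ => tendsto_one_sub_pow_of_tendsto_mul
      (fun n => measureReal_le_one) (hlim l) (tendsto_floor_sub_floor_div h l)
  refine hprod.congr' ?_
  filter_upwards [eventually_ne_atTop 0] with n hn
  have ha : Monotone fun l : ℕ => ⌊(l : ℝ≥0) * h * n⌋₊ := fun l l' hl => by
    have : (l : ℝ≥0) ≤ l' := by exact_mod_cast hl
    dsimp only
    gcongr
  rw [← measureReal_void_eq_prod (hX n) (hindep n) (hlaw n) ha hm]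
  congr 1
  ext ω
  simp only [mem_ofPred_eq, occupiedCells_subset_iff, div_mem_timeSlab_iff hn]

end OccupiedCells

/-! ### Point measures in polar coordinates -/

section PolarPointProcess

variable {T : Type*} [MetricSpace T] [CompactSpace T]

/-- The preimage in polar coordinates of a set of marked functions. -/
def polarPreimage (B : Set (CPlus T × ℝ≥0)) : Set (ExtCone T × ℝ≥0) :=
  (fun p => (ExtCone.unpolar p.1, p.2)) ⁻¹' B

theorem measurableSet_polarPreimage {B : Set (CPlus T × ℝ≥0)} (hB : MeasurableSet B) :
    MeasurableSet (polarPreimage B) :=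
  ((ExtCone.measurable_unpolar.comp measurable_fst).prodMk measurable_snd) hB

theorem isBounded_polarPreimage {B : Set (CPlus T × ℝ≥0)} {ε K : ℝ≥0} (hε : 0 < ε)
    (hB : ∀ p ∈ B, ε ≤ supNorm p.1 ∧ p.2 ≤ K) : Bornology.IsBounded (polarPreimage B) := by
  have h1 := ExtCone.isBounded_unpolar_preimage (T := T) hε (A := {x | ε ≤ supNorm x})
    fun x hx => hx
  have h2 : Bornology.IsBounded (Iic K) := by
    rw [← Icc_bot]
    exact Metric.isBounded_Icc _ _
  exact (h1.prod h2).subset fun p hp => ⟨(hB _ hp).1, (hB _ hp).2⟩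

theorem prod_polarPreimage_prod {ν : Measure (ExtCone T)} {A : Set (CPlus T)}
    (hA : MeasurableSet A) (V : Set ℝ≥0) :
    (ν.prod lebesgueHalfLine) (polarPreimage (A ×ˢ V)) =
      ν.map ExtCone.unpolar A * lebesgueHalfLine V := by
  rw [Measure.map_apply ExtCone.measurable_unpolar hA, ← Measure.prod_prod]
  rfl

variable {I : Set ℕ} (Y : I → CPlusZero T) (U : I → ℝ≥0)

/-- The point measure of a family of points in polar coordinates. -/
noncomputable abbrev polarPointMeasure : Measure (ExtCone T × ℝ≥0) :=
  Measure.sum fun i : I => Measure.dirac (ExtCone.polar (Y i), U i)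

theorem polarPointMeasure_apply {B : Set (CPlus T × ℝ≥0)} (hB : MeasurableSet B) :
    polarPointMeasure Y U (polarPreimage B) = ∑' i, B.indicator 1 ((Y i).1, U i) := by
  rw [Measure.sum_apply _ (measurableSet_polarPreimage hB)]
  refine tsum_congr fun i => ?_
  rw [Measure.dirac_apply' _ (measurableSet_polarPreimage hB)]
  have e : (ExtCone.polar (Y i), U i) ∈ polarPreimage B ↔ ((Y i).1, U i) ∈ B := by
    rw [polarPreimage, mem_preimage, ExtCone.unpolar_polar]
  by_cases h : ((Y i).1, U i) ∈ B
  · rw [indicator_of_mem h, indicator_of_mem (e.2 h)]; rfl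
  · rw [indicator_of_notMem h, indicator_of_notMem (mt e.1 h)]

variable {Y U}

theorem polarPointMeasure_eq_zero_iff {B : Set (CPlus T × ℝ≥0)} (hB : MeasurableSet B) :
    polarPointMeasure Y U (polarPreimage B) = 0 ↔ ∀ i, ((Y i).1, U i) ∉ B := by
  rw [polarPointMeasure_apply Y U hB, ENNReal.tsum_eq_zero]
  refine forall_congr' fun i => ?_
  simp

theorem two_le_polarPointMeasure {B : Set (CPlus T × ℝ≥0)} (hB : MeasurableSet B) {i i' : I}
    (hne : i ≠ i') (hi : ((Y i).1, U i) ∈ B) (hi' : ((Y i').1, U i') ∈ B) :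
    2 ≤ polarPointMeasure Y U (polarPreimage B) := by
  classical
  rw [polarPointMeasure_apply Y U hB]
  refine le_trans ?_ (ENNReal.sum_le_tsum {i, i'})
  rw [Finset.sum_pair hne, indicator_of_mem hi, indicator_of_mem hi']
  simp [one_add_one_eq_two]

theorem finite_of_polarPointMeasure_ne_top {B : Set (CPlus T × ℝ≥0)} (hB : MeasurableSet B)
    (h : polarPointMeasure Y U (polarPreimage B) ≠ ∞) : {i | ((Y i).1, U i) ∈ B}.Finite := by
  rw [polarPointMeasure_apply Y U hB] at h
  refine (ENNReal.finite_const_le_of_tsum_ne_top h one_ne_zero).subset fun i hi => ?_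
  have hi : ((Y i).1, U i) ∈ B := hi
  simp [hi]

theorem IsPointMeasure.apply_ne_top {E : Type*} [PseudoMetricSpace E] [MeasurableSpace E]
    {μ : Measure E} (hμ : IsPointMeasure μ) {B : Set E} (hB : MeasurableSet B)
    (hb : Bornology.IsBounded B) : μ B ≠ ∞ := by
  obtain ⟨I, x, rfl, hfin⟩ := hμ
  rw [Measure.sum_apply _ hB, tsum_eq_sum (s := (hfin B hb).toFinset)]
  · exact ENNReal.sum_ne_top.2 fun i _ => measure_ne_top _ _
  · intro i hi
    rw [Measure.dirac_apply' _ hB, indicator_of_notMem (by simpa using hi)]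

theorem measurableSet_level_prod (ε K : ℝ≥0) :
    MeasurableSet ({w : CPlus T | ε ≤ supNorm w} ×ˢ Iic K) :=
  (isClosed_le_supNorm ε).measurableSet.prod measurableSet_Iic

theorem locallyFinitePoints_of_isPointMeasure (h : IsPointMeasure (polarPointMeasure Y U)) :
    LocallyFinitePoints (fun i => (Y i).1) U := by
  intro ε hε K
  have hB := measurableSet_level_prod (T := T) ε K
  exact finite_of_polarPointMeasure_ne_top hB
    (h.apply_ne_top (measurableSet_polarPreimage hB) (isBounded_polarPreimage hε fun p hp => hp))

end PolarPointProcess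

/-! ### Occupied cells of the Poisson process -/

section PoissonCells

variable {T : Type*} [MetricSpace T] [CompactSpace T] {ν : Measure (ExtCone T)}

theorem lebesgueHalfLine_timeSlab (h : ℝ≥0) (l : ℕ) : lebesgueHalfLine (timeSlab h l) = h := by
  rw [timeSlab, lebesgueHalfLine_Ioc, add_mul, one_mul, add_tsub_cancel_left]

theorem map_unpolar_ne_top (hν : BoundedlyFinite ν) {ε : ℝ≥0} (hε : 0 < ε) :
    ν.map ExtCone.unpolar {w | ε ≤ supNorm w} ≠ ∞ := by
  have hm := (isClosed_le_supNorm (T := T) ε).measurableSet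
  rw [Measure.map_apply ExtCone.measurable_unpolar hm]
  exact (hν _ (ExtCone.measurable_unpolar hm)
    (ExtCone.isBounded_unpolar_preimage hε fun x hx => hx)).ne

theorem disjoint_timeSlab {h : ℝ≥0} {l l' : ℕ} (hne : l ≠ l') :
    Disjoint (timeSlab h l) (timeSlab h l') := by
  wlog hlt : l < l' generalizing l l'
  · exact (this hne.symm (lt_of_le_of_ne (not_lt.1 hlt) hne.symm)).symm
  refine Set.disjoint_left.2 fun u hu hu' => ?_
  have h1 : ((l : ℝ≥0) + 1) ≤ l' := by exact_mod_cast hlt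
  have h2 : ((l : ℝ≥0) + 1) * h ≤ l' * h := by gcongr
  exact absurd (hu.2.trans h2) (not_le.2 hu'.1)

theorem measureReal_polarPreimage_prod {A : Set (CPlus T)} (hA : MeasurableSet A)
    (h : ℝ≥0) (l : ℕ) : (ν.prod lebesgueHalfLine).real (polarPreimage (A ×ˢ timeSlab h l)) =
      (ν.map ExtCone.unpolar).real A * h := by
  rw [measureReal_def, prod_polarPreimage_prod hA, lebesgueHalfLine_timeSlab, ENNReal.toReal_mul]
  rfl

theorem measureReal_polarPreimage_iUnion {L : ℕ} {B : Fin L → Set (CPlus T)}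
    (hB : ∀ l, MeasurableSet (B l)) (hfin : ∀ l, ν.map ExtCone.unpolar (B l) ≠ ∞) (h : ℝ≥0) :
    (ν.prod lebesgueHalfLine).real (polarPreimage (⋃ l : Fin L, B l ×ˢ timeSlab h l)) =
      ∑ l, (ν.map ExtCone.unpolar).real (B l) * h := by
  have e : polarPreimage (⋃ l : Fin L, B l ×ˢ timeSlab h l) =
      ⋃ l : Fin L, polarPreimage (B l ×ˢ timeSlab h l) := preimage_iUnion
  have hm : ∀ l : Fin L, MeasurableSet (B l ×ˢ timeSlab h l) := fun l =>
    (hB l).prod measurableSet_Ioc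
  rw [e, measureReal_def, measure_iUnion, tsum_fintype, ENNReal.toReal_sum]
  · exact Finset.sum_congr rfl fun l _ => measureReal_polarPreimage_prod (hB l) h l
  · intro l _
    rw [prod_polarPreimage_prod (hB l), lebesgueHalfLine_timeSlab]
    exact ENNReal.mul_ne_top (hfin l) ENNReal.coe_ne_top
  · intro l l' hne
    refine Set.disjoint_left.2 fun p hp hp' => ?_
    exact Set.disjoint_left.1 (disjoint_timeSlab (fun e => hne (Fin.ext e))) hp.2 hp'.2
  · exact fun l => measurableSet_polarPreimage (hm l)

variable {Ω' : Type*} [MeasurableSpace Ω'] {P' : Measure Ω'} {I : Ω' → Set ℕ}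
  {Y : ∀ ω, I ω → CPlusZero T} {U : ∀ ω, I ω → ℝ≥0}

theorem timeSlab_subset_Ioc {h : ℝ≥0} {L : ℕ} (l : Fin L) : timeSlab h l ⊆ Ioc 0 (L * h) := by
  intro u hu
  refine ⟨zero_le.trans_lt hu.1, hu.2.trans ?_⟩
  have : ((l : ℕ) + 1 : ℝ≥0) ≤ L := by exact_mod_cast l.2
  gcongr

theorem measurableSet_mem_occupiedCells
    (hN : IsPoissonPointProcess (fun ω => polarPointMeasure (Y ω) (U ω))
      (ν.prod lebesgueHalfLine) P') {J : Type*} {A : J → Set (CPlus T)}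
    (hA : ∀ j, MeasurableSet (A j)) {h : ℝ≥0} {L : ℕ} (s : J × Fin L) :
    MeasurableSet {ω | s ∈ occupiedCells A h L (fun i => (Y ω i).1) (U ω)} := by
  have hB : MeasurableSet (A s.1 ×ˢ timeSlab h s.2) := (hA _).prod measurableSet_Ioc
  have e : {ω | s ∈ occupiedCells A h L (fun i => (Y ω i).1) (U ω)} =
      {ω | polarPointMeasure (Y ω) (U ω) (polarPreimage (A s.1 ×ˢ timeSlab h s.2)) = 0}ᶜ := by
    ext ω
    simp only [mem_compl_iff, mem_ofPred_eq, polarPointMeasure_eq_zero_iff hB, not_forall, not_not]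
    rfl
  rw [e]
  exact (hN.measurable_count (measurableSet_polarPreimage hB) (measurableSet_singleton 0)).compl

/-- The event says that one bounded set contains no point. Its intensity is the sum in the exponent
because the slabs are disjoint and have length `h`. -/
theorem measureReal_occupiedCells_subset
    (hN : IsPoissonPointProcess (fun ω => polarPointMeasure (Y ω) (U ω))
      (ν.prod lebesgueHalfLine) P') (hν : BoundedlyFinite ν) {J : Type*} {A : J → Set (CPlus T)}
    {ε : ℝ≥0} (hε : 0 < ε) (hAε : ∀ j, ∀ w ∈ A j, ε ≤ supNorm w) {h : ℝ≥0} {L : ℕ}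
    {S : Set (J × Fin L)} (hm : ∀ l, MeasurableSet (cellUnion A S l)) :
    P'.real {ω | occupiedCells A h L (fun i => (Y ω i).1) (U ω) ⊆ S} =
      Real.exp (-∑ l, (ν.map ExtCone.unpolar).real (cellUnion A S l) * h) := by
  have hCε : ∀ l, cellUnion A S l ⊆ {w | ε ≤ supNorm w} := fun l w hw => by
    obtain ⟨j, -, hj⟩ := mem_cellUnion.1 hw
    exact hAε j w hj
  have hB : MeasurableSet (⋃ l : Fin L, cellUnion A S l ×ˢ timeSlab h l) :=
    MeasurableSet.iUnion fun l => (hm l).prod measurableSet_Ioc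
  rw [← measureReal_polarPreimage_iUnion hm
    fun l => measure_ne_top_of_subset (hCε l) (map_unpolar_ne_top hν hε),
    ← hN.measureReal_count_eq_zero (measurableSet_polarPreimage hB)]
  · congr 1
    ext ω
    simp only [mem_ofPred_eq, occupiedCells_subset_iff, polarPointMeasure_eq_zero_iff hB,
      mem_iUnion, not_exists, mem_prod, not_and]
    exact ⟨fun H i l h1 h2 => H l i h2 h1, fun H l i h2 h1 => H i l h1 h2⟩
  · refine isBounded_polarPreimage hε (K := L * h) fun p hp => ?_
    obtain ⟨l, hl⟩ := mem_iUnion.1 hp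
    exact ⟨hCε l hl.1, (timeSlab_subset_Ioc l hl.2).2⟩

/-- The configurations with at most one occupied cell in each time slab, and no occupied cell over
the remainder. -/
def simpleCells (κ : Type*) (L : ℕ) : Set (Set (Option κ × Fin L)) :=
  {S | ∀ s ∈ S, s.1 ≠ none ∧ ∀ s' ∈ S, s'.2 = s.2 → s' = s}

/-- A bad configuration has either a point over the remainder or two points of norm at least `ε` in
one slab, as distinct cells over a slab are disjoint. The first term bounds the former, and the
square bounds the latter in each of the `L` slabs. -/
theorem measure_occupiedCells_notMem_simpleCells_le [IsProbabilityMeasure P']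
    (hN : IsPoissonPointProcess (fun ω => polarPointMeasure (Y ω) (U ω))
      (ν.prod lebesgueHalfLine) P') {κ : Type*} {A : Option κ → Set (CPlus T)}
    (hA : ∀ j, MeasurableSet (A j)) {ε : ℝ≥0} (hε : 0 < ε)
    (hAε : ∀ j, ∀ w ∈ A j, ε ≤ supNorm w) (hdisj : ∀ j j' w, w ∈ A j → w ∈ A j' → j = j')
    {h : ℝ≥0} {L : ℕ} :
    P' {ω | occupiedCells A h L (fun i => (Y ω i).1) (U ω) ∉ simpleCells κ L} ≤
      ENNReal.ofReal ((ν.map ExtCone.unpolar).real (A none) * (L * h) +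
        L * ((ν.map ExtCone.unpolar).real {w | ε ≤ supNorm w} * h) ^ 2) := by
  set ν₀ := ν.map ExtCone.unpolar
  have hCm := (isClosed_le_supNorm (T := T) ε).measurableSet
  have hB : MeasurableSet (A none ×ˢ Ioc 0 ((L : ℝ≥0) * h)) := (hA none).prod measurableSet_Ioc
  have hC : ∀ l : ℕ, MeasurableSet ({w : CPlus T | ε ≤ supNorm w} ×ˢ timeSlab h l) := fun l =>
    hCm.prod measurableSet_Ioc
  have h1 : P'.real {ω | polarPointMeasure (Y ω) (U ω)
      (polarPreimage (A none ×ˢ Ioc 0 ((L : ℝ≥0) * h))) ≠ 0} ≤ ν₀.real (A none) * (L * h) := by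
    refine (hN.measureReal_count_ne_zero_le (measurableSet_polarPreimage hB)
      (isBounded_polarPreimage hε (K := L * h) fun p hp => ⟨hAε _ _ hp.1, hp.2.2⟩)).trans_eq ?_
    rw [measureReal_def, prod_polarPreimage_prod (hA none), lebesgueHalfLine_Ioc,
      ENNReal.toReal_mul, tsub_zero]
    simp [measureReal_def, ν₀]
  have h2 : ∀ l : Fin L, P'.real {ω | 2 ≤ polarPointMeasure (Y ω) (U ω)
      (polarPreimage ({w : CPlus T | ε ≤ supNorm w} ×ˢ timeSlab h l))} ≤
        (ν₀.real {w | ε ≤ supNorm w} * h) ^ 2 := by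
    intro l
    refine (hN.measureReal_two_le_count_le (measurableSet_polarPreimage (hC l))
      (isBounded_polarPreimage hε (K := L * h)
        fun p hp => ⟨hp.1, (timeSlab_subset_Ioc l hp.2).2⟩)).trans_eq ?_
    rw [measureReal_polarPreimage_prod hCm]
  have hsub : {ω | occupiedCells A h L (fun i => (Y ω i).1) (U ω) ∉ simpleCells κ L} ⊆
      {ω | polarPointMeasure (Y ω) (U ω)
        (polarPreimage (A none ×ˢ Ioc 0 ((L : ℝ≥0) * h))) ≠ 0} ∪
      ⋃ l : Fin L, {ω | 2 ≤ polarPointMeasure (Y ω) (U ω)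
        (polarPreimage ({w : CPlus T | ε ≤ supNorm w} ×ˢ timeSlab h l))} := by
    intro ω hω
    by_contra hn
    rw [mem_union, not_or] at hn
    obtain ⟨hn1, hn2⟩ := hn
    have hn1' := (polarPointMeasure_eq_zero_iff hB).1 (not_not.1 hn1)
    refine hω fun s hs => ?_
    obtain ⟨j, l⟩ := s
    obtain ⟨i, hi, hil⟩ := hs
    refine ⟨?_, ?_⟩
    · rintro rfl
      exact hn1' i ⟨hi, timeSlab_subset_Ioc l hil⟩
    · rintro ⟨j', l'⟩ ⟨i', hi', hil'⟩ (rfl : l' = l)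
      by_contra hne
      have hii' : i ≠ i' := by
        rintro rfl
        obtain rfl : j = j' := hdisj _ _ _ hi hi'
        exact hne rfl
      exact hn2 (mem_iUnion.2 ⟨l', two_le_polarPointMeasure (hC l') hii'
        ⟨hAε _ _ hi, hil⟩ ⟨hAε _ _ hi', hil'⟩⟩)
  refine (measure_mono hsub).trans ?_
  rw [← ofReal_measureReal]
  refine ENNReal.ofReal_le_ofReal ((measureReal_union_le _ _).trans (add_le_add h1 ?_))
  refine (measureReal_iUnion_fintype_le _).trans ((Finset.sum_le_sum fun l _ => h2 l).trans_eq ?_)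
  simp

/-- The slabs leave out time `0`, and the slice at time `0` has intensity zero. -/
theorem ae_pos_time [IsProbabilityMeasure P']
    (hN : IsPoissonPointProcess (fun ω => polarPointMeasure (Y ω) (U ω))
      (ν.prod lebesgueHalfLine) P') {ε : ℝ≥0} (hε : 0 < ε) :
    ∀ᵐ ω ∂P', ∀ i, ε ≤ supNorm (Y ω i).1 → 0 < U ω i := by
  have hCm := (isClosed_le_supNorm (T := T) ε).measurableSet
  have hB : MeasurableSet ({w : CPlus T | ε ≤ supNorm w} ×ˢ {(0 : ℝ≥0)}) :=
    hCm.prod (measurableSet_singleton 0)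
  have h1 := hN.measureReal_count_ne_zero_le (measurableSet_polarPreimage hB)
    (isBounded_polarPreimage hε (K := 0) fun p hp => ⟨hp.1, le_of_eq hp.2⟩)
  rw [measureReal_def (μ := ν.prod _), prod_polarPreimage_prod hCm,
    lebesgueHalfLine_singleton, mul_zero, ENNReal.toReal_zero] at h1
  have h2 := le_antisymm h1 measureReal_nonneg
  rw [measureReal_eq_zero_iff] at h2
  have h3 : ∀ᵐ ω ∂P', polarPointMeasure (Y ω) (U ω)
      (polarPreimage ({w : CPlus T | ε ≤ supNorm w} ×ˢ {(0 : ℝ≥0)})) = 0 := h2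
  filter_upwards [h3] with ω hω i hi
  exact pos_iff_ne_zero.2 fun h0 => (polarPointMeasure_eq_zero_iff hB).1 hω i ⟨hi, h0⟩

end PoissonCells

/-! ### Choice of the discretization and conclusion -/

theorem FinitelyApproximable.mono {Ω : ℕ → Type*} [∀ n, MeasurableSpace (Ω n)]
    {P : ∀ n, Measure (Ω n)} {Ω' : Type*} [MeasurableSpace Ω'] {P' : Measure Ω'} {D : Type*}
    {close close' : ℝ → D → D → Prop} {X : ∀ n, Ω n → D} {X' : Ω' → D}
    (H : FinitelyApproximable P P' close X X')
    (h : ∀ δ > 0, ∃ δ' > 0, δ' ≤ δ ∧ ∀ x y, close δ' x y → close' δ x y) :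
    FinitelyApproximable P P' close' X X' := by
  intro δ hδ
  obtain ⟨δ', hδ', hle, hcl⟩ := h δ hδ
  obtain ⟨F, hF, ξ, ξ', G, z, h1, h2, h3, h4, h5, h6⟩ := H δ' hδ'
  refine ⟨F, hF, ξ, ξ', G, z, h1, h2, h3, h4.trans (ENNReal.ofReal_le_ofReal hle), ?_, ?_⟩
  · filter_upwards [h5] with n hn
    filter_upwards [hn] with ω hω hG using hcl _ _ (hω hG)
  · filter_upwards [h6] with ω hω hG using hcl _ _ (hω hG)

/-- The discretization in space and time which approximates both the partial maxima and the
supremum of the Poisson points. -/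
theorem finitelyApproximable_maxima {T : Type*} [MetricSpace T] [CompactSpace T]
    {Ω : ℕ → Type*} [∀ n, MeasurableSpace (Ω n)] {P : ∀ n, Measure (Ω n)}
    [∀ n, IsProbabilityMeasure (P n)] {X : ∀ n, ℕ → Ω n → CPlus T}
    (hX : ∀ n i, AEMeasurable (X n i) (P n)) (hindep : ∀ n, iIndepFun (X n) (P n))
    {μ : ℕ → Measure (CPlus T)} (hlaw : ∀ n i, (P n).map (X n i) = μ n)
    {ν : Measure (ExtCone T)}
    (hconv : SharpWeakTendsto (fun n => (n : ℝ≥0∞) • ExtCone.inducedMeasure (μ n)) ν)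
    (hν : ν {p | p.radius = ∞} = 0)
    {Ω' : Type*} [MeasurableSpace Ω'] {P' : Measure Ω'} [IsProbabilityMeasure P']
    {I : Ω' → Set ℕ} {Y : ∀ ω, I ω → CPlusZero T} {U : ∀ ω, I ω → ℝ≥0}
    (hN : IsPoissonPointProcess (fun ω => polarPointMeasure (Y ω) (U ω))
      (ν.prod lebesgueHalfLine) P')
    {M : ∀ n, Ω n → SkorokhodSpace (CPlus T)} {M' : Ω' → SkorokhodSpace (CPlus T)}
    (hM : ∀ n, n ≠ 0 → ∀ ω, IsSupPath (fun i => X n i ω) (fun i => ((i : ℝ≥0) + 1) / n) (M n ω))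
    (hM' : ∀ ω, IsSupPath (fun i => (Y ω i).1) (U ω) (M' ω)) :
    FinitelyApproximable P P' (fun δ x z => x ∈ z.basicNhd (Real.toNNReal (1 / δ)) δ) M M' := by
  intro δ hδ
  lift δ to ℝ≥0 using hδ.le
  have hδ : 0 < δ := hδ
  have hbf := hconv.boundedlyFinite_limit
  set ν₀ := ν.map ExtCone.unpolar with hν₀
  obtain ⟨ε, hε, hεδ, hεfr⟩ :=
    exists_level_null_frontier (ν := ν₀) (fun ε hε => map_unpolar_ne_top hbf hε) hδ
  obtain ⟨K, hK⟩ : ∃ K : ℝ≥0, K = Real.toNNReal (1 / δ) + 1 := ⟨_, rfl⟩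
  have hK0 : 0 < K := by rw [hK]; exact add_pos_of_nonneg_of_pos zero_le one_pos
  set c := ν₀.real {w | ε ≤ supNorm w} with hc
  have hc0 : 0 ≤ c := measureReal_nonneg
  -- A remainder of this mass is hit before time `K` with probability at most `δ / 2`.
  have hη : (0 : ℝ) < δ / (2 * K) := div_pos hδ (mul_pos two_pos hK0)
  obtain ⟨k, A, y, hAm, hAfr, hAcov, hAdisj, hAy, hAη⟩ :=
    exists_partition (isClosed_le_supNorm (T := T) ε) (map_unpolar_ne_top hbf hε) hεfr
      (δ := δ) hδ (ENNReal.ofReal_pos.2 hη)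
  have hAε : ∀ j, ∀ w ∈ A j, ε ≤ supNorm w := fun j w hw => (hAcov w).1 ⟨j, hw⟩
  -- With `h = K / L`, the first summand gives `2 * h ≤ δ` and the second bounds by `δ / 2` the
  -- probability `L (c h)² = (K c)² / L` of two large points in a slab.
  obtain ⟨L, hL⟩ := exists_nat_gt (2 * (K : ℝ) / δ + 2 * (K * c) ^ 2 / δ)
  have hK0' : (0 : ℝ) < K := hK0
  have hδ' : (0 : ℝ) < δ := hδ
  have hL0' : (0 : ℝ) < L := lt_of_le_of_lt (by positivity) hL
  have hL0 : (0 : ℝ≥0) < L := by exact_mod_cast hL0'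
  have hL1 : 2 * (K : ℝ) / δ < L := lt_of_le_of_lt (le_add_of_nonneg_right (by positivity)) hL
  have hL2 : 2 * (K * c) ^ 2 / δ < L := lt_of_le_of_lt (le_add_of_nonneg_left (by positivity)) hL
  set h := K / L with hh
  have hh0 : 0 < h := div_pos hK0 hL0
  have hLh : L * h = K := mul_div_cancel₀ _ hL0.ne'
  have h2h : 2 * h ≤ δ := by
    rw [hh, ← NNReal.coe_le_coe]
    push_cast
    rw [div_lt_iff₀ hδ'] at hL1
    rw [← mul_div_assoc, div_le_iff₀ hL0']
    linarith
  have hbad : ν₀.real (A none) * (L * h) + L * (c * h) ^ 2 ≤ δ := by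
    have e1 : (L : ℝ) * h = K := by exact_mod_cast hLh
    have e2 : (h : ℝ) = K / L := by rw [hh]; push_cast; rfl
    have i1 : ν₀.real (A none) ≤ δ / (2 * K) := ENNReal.toReal_le_of_le_ofReal hη.le hAη
    have i2 : ν₀.real (A none) * K ≤ δ / 2 := by
      refine (mul_le_mul_of_nonneg_right i1 hK0'.le).trans_eq ?_
      field_simp
    have i3 : L * (c * (h : ℝ)) ^ 2 ≤ δ / 2 := by
      rw [e2]
      have : L * (c * ((K : ℝ) / L)) ^ 2 = (K * c) ^ 2 / L := by field_simp
      rw [this, div_le_iff₀ hL0']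
      rw [div_lt_iff₀ hδ'] at hL2
      linarith
    rw [e1]
    linarith
  have hcellm : ∀ (S : Set (Option (Fin k) × Fin L)) l, MeasurableSet (cellUnion A S l) :=
    fun S l => MeasurableSet.biUnion (to_countable _) fun j _ => hAm j
  have hcellε : ∀ (S : Set (Option (Fin k) × Fin L)) l, ∀ w ∈ cellUnion A S l, ε ≤ supNorm w := by
    intro S l w hw
    obtain ⟨j, -, hj⟩ := mem_cellUnion.1 hw
    exact hAε j w hj
  -- The model path of a configuration: each occupied cell contributes its centre at the end of its
  -- slab.
  have hz : ∀ S : Set (Option (Fin k) × Fin L), ∃ z : SkorokhodSpace (CPlus T),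
      IsSupPath (fun s : S => y s.1.1) (fun s : S => ((s.1.2 : ℕ) + 1) * h) z := fun S =>
    LocallyFinitePoints.exists_isSupPath fun _ _ _ => toFinite _
  choose z hz using hz
  have hclose : ∀ {J : Type _} {Y : J → CPlus T} {U : J → ℝ≥0} {x : SkorokhodSpace (CPlus T)},
      IsSupPath Y U x → LocallyFinitePoints Y U → (∀ i, ε ≤ supNorm (Y i) → 0 < U i) →
      occupiedCells A h L Y U ∈ simpleCells (Fin k) L →
      x ∈ (z (occupiedCells A h L Y U)).basicNhd (Real.toNNReal (1 / δ)) δ := by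
    intro J Y U x hx hfin hU hS
    refine SkorokhodSpace.basicNhd_anti _ (le_refl _) ?_
      (hx.mem_basicNhd hfin hε hh0 hU hAcov hεδ hAy (fun s => Iff.rfl) hS (hz _)
        (K := Real.toNNReal (1 / δ)) ?_)
    · exact max_le le_rfl (by exact_mod_cast h2h)
    · rw [hLh, hK]
      exact le_self_add
  have hξ : ∀ n S, NullMeasurableSet {ω | occupiedCells A h L (fun i => X n i ω)
      (fun i => ((i : ℝ≥0) + 1) / n) = S} (P n) := by
    refine fun n => nullMeasurableSet_eq_of_mem fun s => ?_
    have e : {ω | s ∈ occupiedCells A h L (fun i => X n i ω) (fun i => ((i : ℝ≥0) + 1) / n)} =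
        ⋃ i : ℕ, ⋃ _ : ((i : ℝ≥0) + 1) / n ∈ timeSlab h s.2, X n i ⁻¹' A s.1 := by
      ext ω
      simp only [occupiedCells, mem_ofPred_eq, mem_iUnion, mem_preimage, exists_prop]
      exact exists_congr fun i => and_comm
    rw [e]
    exact NullMeasurableSet.iUnion fun i => NullMeasurableSet.iUnion fun _ =>
      (hX n i).nullMeasurableSet_preimage (hAm _)
  have hξ' : ∀ S, NullMeasurableSet
      {ω | occupiedCells A h L (fun i => (Y ω i).1) (U ω) = S} P' :=
    nullMeasurableSet_eq_of_mem fun s =>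
      (measurableSet_mem_occupiedCells hN hAm s).nullMeasurableSet
  refine ⟨Set (Option (Fin k) × Fin L), inferInstance,
    fun n ω => occupiedCells A h L (fun i => X n i ω) (fun i => ((i : ℝ≥0) + 1) / n),
    fun ω => occupiedCells A h L (fun i => (Y ω i).1) (U ω), simpleCells (Fin k) L, z, hξ, hξ',
    tendsto_measureReal_eq_of_subset hξ hξ' fun S => ?_, ?_, ?_, ?_⟩
  · rw [measureReal_occupiedCells_subset hN hbf hε hAε (hcellm S)]
    exact tendsto_occupiedCells_maxima_subset hX hindep hlaw (hcellm S) fun l =>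
      ExtCone.tendsto_mul_measureReal hconv hν (hcellm S l) hε (hcellε S l)
        (null_frontier_biUnion hAfr (toFinite _))
  · exact (measure_occupiedCells_notMem_simpleCells_le hN hAm hε hAε hAdisj).trans
      (ENNReal.ofReal_le_ofReal hbad)
  · filter_upwards [eventually_ne_atTop 0] with n hn
    refine Eventually.of_forall fun ω => hclose (hM n hn ω) (locallyFinitePoints_maxima hn _) ?_
    intro i _
    have : (0 : ℝ≥0) < n := by exact_mod_cast pos_iff_ne_zero.2 hn
    exact div_pos (add_pos_of_nonneg_of_pos zero_le one_pos) this
  · filter_upwards [ae_pos_time hN hε] with ω hω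
    exact hclose (hM' ω) (locallyFinitePoints_of_isPointMeasure (hN.isPointMeasure ω)) hω

theorem theorem2 {T : Type*} [MetricSpace T] [CompactSpace T]
    -- for each `n`, the process `X n` and its independent copies `Xc n 0`, `Xc n 1`, …
    {Ω₀ : ℕ → Type*} [∀ n, MeasurableSpace (Ω₀ n)] (P₀ : ∀ n, Measure (Ω₀ n))
    [∀ n, IsProbabilityMeasure (P₀ n)] (X : ∀ n, Ω₀ n → CPlus T)
    {Ω : ℕ → Type*} [∀ n, MeasurableSpace (Ω n)] (P : ∀ n, Measure (Ω n))
    [∀ n, IsProbabilityMeasure (P n)] (Xc : ∀ n, ℕ → Ω n → CPlus T)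
    (hcopy : ∀ n i, IdentDistrib (Xc n i) (X n) (P n) (P₀ n))
    (hindep : ∀ n, iIndepFun (Xc n) (P n))
    -- `n ℙ[X_n ∈ ·]` converges to `ν`, which does not charge the points with infinite radius
    (ν : Measure (ExtCone T))
    (hconv : SharpWeakTendsto
      (fun n => (n : ℝ≥0∞) • ExtCone.inducedMeasure ((P₀ n).map (X n))) ν)
    (hν : ν {p | p.radius = ∞} = 0)
    -- a Poisson point process `∑ δ_(Y_i, U_i)` on `C₀⁺ × [0,∞)` with intensity `ν ⊗ Lebesgue`;
    -- the index set may be random, so as to allow finitely many points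
    {Ω' : Type*} [MeasurableSpace Ω'] (P' : Measure Ω') [IsProbabilityMeasure P']
    (I : Ω' → Set ℕ) (Y : ∀ ω, I ω → CPlusZero T) (U : ∀ ω, I ω → ℝ≥0)
    (hPoisson : IsPoissonPointProcess
      (fun ω => Measure.sum (fun i : I ω => Measure.dirac (ExtCone.polar (Y ω i), U ω i)))
      (ν.prod lebesgueHalfLine) P') :
    -- the maxima define processes with paths in the Skorokhod space, and these converge weakly
    ∃ (M : ∀ n, Ω n → SkorokhodSpace (CPlus T)) (M' : Ω' → SkorokhodSpace (CPlus T)),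
      (∀ n ω u t, M n ω u t =
        (Finset.range ⌊(n : ℝ≥0) * u⌋₊).sup (fun i => Xc n i ω t)) ∧
      (∀ ω u t, IsLUB
        (Set.range (fun i : I ω => (Set.Ici (U ω i)).indicator (fun _ => (Y ω i).1 t) u))
        (M' ω u t)) ∧
      TendstoInDistribution M atTop M' P P' := by
  have hXm : ∀ n i, AEMeasurable (Xc n i) (P n) := fun n i => (hcopy n i).aemeasurable_fst
  have hlaw : ∀ n i, (P n).map (Xc n i) = (P₀ n).map (X n) := fun n i => (hcopy n i).map_eq
  choose Φ hΦ using fun n => exists_maxima_path (T := T) n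
  have hpath : ∀ ω, ∃ x, IsSupPath (fun i => (Y ω i).1) (U ω) x := fun ω =>
    (locallyFinitePoints_of_isPointMeasure (hPoisson.isPointMeasure ω)).exists_isSupPath
  choose M' hM' using hpath
  refine ⟨fun n ω => Φ n fun i => Xc n i ω, M', fun n ω u t => hΦ n _ u t,
    fun ω u t => isLUB_range_indicator_iff.2 (hM' ω u t), ?_⟩
  have happrox := finitelyApproximable_maxima hXm hindep hlaw hconv hν hPoisson
    (M := fun n ω => Φ n fun i => Xc n i ω) (M' := M')
    (fun n hn ω => (isSupPath_iff_of_maxima hn).2 (hΦ n _)) hM'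
  have hmeas : ∀ n, AEMeasurable (fun ω => Φ n fun i => Xc n i ω) (P n) := fun n =>
    (continuous_maxima_path (hΦ n)).measurable.comp_aemeasurable (aemeasurable_pi_lambda _ (hXm n))
  let _ : UniformSpace (SkorokhodSpace (CPlus T)) := SkorokhodSpace.uniformSpace
  have := SkorokhodSpace.isCountablyGenerated_uniformity (E := CPlus T)
  -- This pseudometric induces the `J₁` topology itself, so Borel sets and weak convergence are
  -- unchanged.
  let _ : PseudoMetricSpace (SkorokhodSpace (CPlus T)) := UniformSpace.pseudoMetricSpace _
  refine (happrox.mono fun δ hδ => ?_).tendstoInDistribution hmeas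
  obtain ⟨K, ε, hε, h⟩ :=
    SkorokhodSpace.exists_basicNhd_of_mem_uniformity (E := CPlus T)
      (V := {p | dist p.1 p.2 < δ}) (Metric.dist_mem_uniformity hδ)
  have hK : (0 : ℝ) < 1 / (K + 1) := by positivity
  -- The bound `1 / (K + 1)` forces the horizon, the reciprocal of the new parameter, to be at least
  -- `K`.
  refine ⟨min δ (min ε (1 / (K + 1))), lt_min hδ (lt_min hε hK), min_le_left _ _,
    fun x z hxz => ?_⟩
  rw [dist_comm]
  refine le_of_lt (h z x (z.basicNhd_anti ?_ ((min_le_right _ _).trans (min_le_left _ _)) hxz))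
  rw [← NNReal.coe_le_coe, NNReal.coe_natCast]
  refine le_trans ?_ (Real.le_coe_toNNReal _)
  have h1 : min δ (min ε (1 / ((K : ℝ) + 1))) ≤ 1 / (K + 1) :=
    (min_le_right _ _).trans (min_le_right _ _)
  have h2 := one_div_le_one_div_of_le (lt_min hδ (lt_min hε hK)) h1
  rw [one_div_one_div] at h2
  linarith
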